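/- Let $\mathbb F$ be a field of characteristic $0$, let $n\ge 1$, and let $V$ be a finite-dimensional irreducible $gl(n)$-module over $\mathbb F$ with highest weight $\mu=(\mu_1,\dots,\mu_n)$, i.e. $V$ contains a nonzero vector killed by all $E_{i,j}$ with $i<j$ on which $E_{i,i}$ acts as $\mu_i\in\mathbb F$ (so that all $\mu_i-\mu_{i+1}\in\mathbb N=\{0,1,2,\dots\}$). Put $|\mu|=\sum_{j=1}^n\mu_j$ and $\mathcal A=\mathbb F[x_1,\dots,x_n]$. The Lie algebra $\mathcal W(n)=\{\sum_i a_i\partial_{x_i}\mid a_i\in\mathcal A\}$ acts on $\mathcal A\otimes V$ by $$\pi\Big(\sum_{i} a_i\partial_{x_i}\Big)=\sum_{i,j=1}^n\partial_{x_i}(a_j)\otimes E_{i,j}+\sum_{i=1}^n a_i\partial_{x_i}\otimes \mathrm{Id}_V .$$ Let $p_i=x_i\sum_{r=1}^n x_r\partial_{x_r}$ and $P=\sum_i\mathbb F p_i$ (an abelian Lie algebra), and let $L_{n+1}=\sum_{i,j}\mathbb Fx_i\partial_{x_j}+\sum_i\mathbb F\partial_{x_i}+P\subset\mathcal W(n)$,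 which is isomorphic to $sl(n+1)$ with positive Chevalley generators $e_i=x_i\partial_{x_{i+1}}$ $(i<n)$, $e_n=p_n$ and simple coroots $h_i=x_i\partial_{x_i}-x_{i+1}\partial_{x_{i+1}}$ $(i<n)$, $h_n=\sum_r x_r\partial_{x_r}+x_n\partial_{x_n}$. Let $\omega_1,\dots,\omega_n$ be the fundamental weights, $\omega_i(h_j)=\delta_{i,j}$. For $k\in\mathbb N$ let $(\mathcal A\otimes V)_{\langle k\rangle}$ be the span of all $x^{c}\otimes v$ with $|c|=k$, $v\in V$, and $(U(P)(1\otimes V))_{\langle k\rangle}$ the span of all $p_{i_1}\cdots p_{i_k}(1\otimes v)$ with $i_1\le\dots\le i_k$, $v\in V$; here $U(P)$ is the universal enveloping algebra of $P$. Suppose that at least one of the following conditions fails (for $n=1$ only $\mu_1+|\mu|\notin-\mathbb N$ is required in the first one): $$\mu_1+|\mu|\notin -\mathbb N\cup\{2,\dots,1+\mu_1-\mu_2\};\qquad \mu_i+|\mu|-i\notin\{1,\dots,\mu_i-\mu_{i+1}\}\ \text{ for } 2\le i\le n-1 .$$ Then $\{i\in\{1,\dots,n\}\mid \mu_i+|\mu|-i+1\in-\mathbb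 N\}$ is non-empty; let $i_0$ be its least element. We have: (i) $k=-\mu_{i_0}-|\mu|+i_0-1$ is a nonnegative integer, $(\mathcal A\otimes V)_{\langle j\rangle}=(U(P)(1\otimes V))_{\langle j\rangle}$ for all $0\le j\le k$, and $(\mathcal A\otimes V)_{\langle j\rangle}\ne(U(P)(1\otimes V))_{\langle j\rangle}$ for all $j\ge k+1$. (ii) $U(P)(1\otimes V)$ is an irreducible $L_{n+1}$-submodule of $\mathcal A\otimes V$, and it is a finite-dimensional highest weight module of highest weight $k\omega_1+\sum_{i=2}^{n}(\mu_{i-1}-\mu_i)\omega_i$ if and only if $i_0=1$. -/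

import Mathlib

open scoped TensorProduct

/- Matrices and endomorphisms are Lie algebras under the commutator. -/
attribute [local instance 100] LieRing.ofAssociativeRing

noncomputable section

namespace GenProj

variable (F : Type*) [Field F] (n : ℕ)

/-- The polynomial algebra `𝒜 = F[x₁, …, xₙ]`. -/
abbrev PolyAlg := MvPolynomial (Fin n) F

/-- The Witt algebra `𝒲(n)` of all derivations `∑ aᵢ ∂ᵢ` of `F[x₁, …, xₙ]`. -/
abbrev Witt := Derivation F (PolyAlg F n) (PolyAlg F n)

/-- The general linear Lie algebra `gl(n)`. -/
abbrev Gl := Matrix (Fin n) (Fin n) F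

variable {n}

/-- The matrix unit `E_{i,j}`. -/
def E (i j : Fin n) : Gl F n := Matrix.single i j 1

/-- The partial derivative `∂_{x_i}`. -/
def pd (i : Fin n) : Witt F n := MvPolynomial.pderiv i

/-- The operator `x_i ∂_{x_j}`. -/
def xpd (i j : Fin n) : Witt F n := (MvPolynomial.X i : PolyAlg F n) • pd F j

variable (n) in
/-- The degree operator `∑ᵣ x_r ∂_{x_r}`. -/
def euler : Witt F n := ∑ r : Fin n, xpd F r r

/-- The pseudo-translation `p_i = x_i ∑ᵣ x_r ∂_{x_r}`. -/
def pt (i : Fin n) : Witt F n := (MvPolynomial.X i : PolyAlg F n) • euler F n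

theorem pd_X (i l : Fin n) :
    pd F i (MvPolynomial.X l : PolyAlg F n) = if i = l then 1 else 0 := by
  simp [pd, MvPolynomial.pderiv_X, Pi.single_apply, eq_comm]

theorem xpd_X (i j l : Fin n) :
    xpd F i j (MvPolynomial.X l : PolyAlg F n) = if j = l then MvPolynomial.X i else 0 := by
  simp [xpd, pd_X]

theorem sum_apply {ι : Type*} (s : Finset ι) (D : ι → Witt F n) (g : PolyAlg F n) :
    (∑ r ∈ s, D r) g = ∑ r ∈ s, D r g := by
  have h : ⇑(∑ r ∈ s, D r) = ∑ r ∈ s, ⇑(D r) := map_sum Derivation.coeFnAddMonoidHom _ _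
  rw [h, Finset.sum_apply]

theorem euler_X (l : Fin n) :
    euler F n (MvPolynomial.X l : PolyAlg F n) = MvPolynomial.X l := by
  simp [euler, sum_apply, xpd_X]

theorem pt_X (i l : Fin n) :
    pt F i (MvPolynomial.X l : PolyAlg F n) = MvPolynomial.X i * MvPolynomial.X l := by
  simp [pt, euler_X]

theorem lie_pd_pd (i j : Fin n) : ⁅pd F i, pd F j⁆ = 0 := by
  apply MvPolynomial.derivation_ext
  intro l
  simp only [Derivation.commutator_apply, pd_X]
  split_ifs <;> simp

theorem lie_pt_pt (i j : Fin n) : ⁅pt F i, pt F j⁆ = 0 := by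
  apply MvPolynomial.derivation_ext
  intro l
  simp [Derivation.commutator_apply, pt_X]
  ring

theorem lie_xpd_pd (i j k : Fin n) :
    ⁅xpd F i j, pd F k⁆ = if i = k then -pd F j else 0 := by
  apply MvPolynomial.derivation_ext
  intro l
  simp only [Derivation.commutator_apply, pd_X, xpd_X]
  split_ifs <;> simp_all [pd_X, eq_comm]

theorem lie_xpd_pt (i j k : Fin n) :
    ⁅xpd F i j, pt F k⁆ = if j = k then pt F i else 0 := by
  apply MvPolynomial.derivation_ext
  intro l
  simp only [Derivation.commutator_apply, pt_X, xpd_X]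
  split_ifs <;> simp_all [pt_X, xpd_X] <;> ring

theorem lie_xpd_xpd (i j k l : Fin n) :
    ⁅xpd F i j, xpd F k l⁆ =
      (if j = k then xpd F i l else 0) - (if l = i then xpd F k j else 0) := by
  apply MvPolynomial.derivation_ext
  intro m
  simp only [Derivation.commutator_apply, xpd_X]
  split_ifs <;> simp_all [xpd_X]

theorem lie_pd_pt (j i : Fin n) :
    ⁅pd F j, pt F i⁆ = xpd F i j + if j = i then euler F n else 0 := by
  apply MvPolynomial.derivation_ext
  intro l
  simp only [Derivation.commutator_apply, pt_X, pd_X]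
  split_ifs <;> simp_all [pd_X, xpd_X, euler_X]

/-- The subspace spanned by a set whose pairwise brackets lie in it is a Lie subalgebra. -/
theorem span_lie_mem {L : Type*} [LieRing L] [LieAlgebra F L] {S : Set L}
    (h : ∀ x ∈ S, ∀ y ∈ S, ⁅x, y⁆ ∈ Submodule.span F S) {x y : L}
    (hx : x ∈ Submodule.span F S) (hy : y ∈ Submodule.span F S) :
    ⁅x, y⁆ ∈ Submodule.span F S := by
  induction hx, hy using Submodule.span_induction₂ with
  | mem_mem x y hx hy => exact h x hx y hy
  | zero_left y hy => simp
  | zero_right x hx => simp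
  | add_left x y z _ _ _ h1 h2 => rw [add_lie]; exact add_mem h1 h2
  | add_right x y z _ _ _ h1 h2 => rw [lie_add]; exact add_mem h1 h2
  | smul_left r x y _ _ h => rw [smul_lie]; exact Submodule.smul_mem _ _ h
  | smul_right r x y _ _ h => rw [lie_smul]; exact Submodule.smul_mem _ _ h

variable (n) in
/-- The spanning set `{x_i ∂_{x_j}, ∂_{x_i}, p_i}` of `L_{n+1}`. -/
def projGens : Set (Witt F n) :=
  {D | (∃ i j, D = xpd F i j) ∨ (∃ i, D = pd F i) ∨ ∃ i, D = pt F i}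

theorem xpd_mem_span (i j : Fin n) : xpd F i j ∈ Submodule.span F (projGens F n) :=
  Submodule.subset_span (Or.inl ⟨i, j, rfl⟩)

theorem pd_mem_span (i : Fin n) : pd F i ∈ Submodule.span F (projGens F n) :=
  Submodule.subset_span (Or.inr (Or.inl ⟨i, rfl⟩))

theorem pt_mem_span (i : Fin n) : pt F i ∈ Submodule.span F (projGens F n) :=
  Submodule.subset_span (Or.inr (Or.inr ⟨i, rfl⟩))

theorem euler_mem_span : euler F n ∈ Submodule.span F (projGens F n) :=
  Submodule.sum_mem _ fun r _ => xpd_mem_span F r r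

theorem projGens_lie_mem : ∀ x ∈ projGens F n, ∀ y ∈ projGens F n,
    ⁅x, y⁆ ∈ Submodule.span F (projGens F n) := by
  have h1 : ∀ i j k : Fin n, ⁅xpd F i j, pd F k⁆ ∈ Submodule.span F (projGens F n) := by
    intro i j k
    rw [lie_xpd_pd]
    split_ifs
    exacts [neg_mem (pd_mem_span F j), zero_mem _]
  have h2 : ∀ i j k : Fin n, ⁅xpd F i j, pt F k⁆ ∈ Submodule.span F (projGens F n) := by
    intro i j k
    rw [lie_xpd_pt]
    split_ifs
    exacts [pt_mem_span F i, zero_mem _]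
  have h3 : ∀ i j : Fin n, ⁅pd F i, pt F j⁆ ∈ Submodule.span F (projGens F n) := by
    intro i j
    rw [lie_pd_pt]
    split_ifs
    exacts [add_mem (xpd_mem_span F j i) (euler_mem_span F),
      add_mem (xpd_mem_span F j i) (zero_mem _)]
  have h4 : ∀ i j k l : Fin n, ⁅xpd F i j, xpd F k l⁆ ∈ Submodule.span F (projGens F n) := by
    intro i j k l
    rw [lie_xpd_xpd]
    refine sub_mem ?_ ?_ <;> split_ifs
    exacts [xpd_mem_span F i l, zero_mem _, xpd_mem_span F k j, zero_mem _]
  rintro x (⟨i, j, rfl⟩ | ⟨i, rfl⟩ | ⟨i, rfl⟩) y (⟨k, l, rfl⟩ | ⟨k, rfl⟩ | ⟨k, rfl⟩)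
  · exact h4 i j k l
  · exact h1 i j k
  · exact h2 i j k
  · rw [← lie_skew]; exact neg_mem (h1 k l i)
  · rw [lie_pd_pd]; exact zero_mem _
  · exact h3 i k
  · rw [← lie_skew]; exact neg_mem (h2 k l i)
  · rw [← lie_skew]; exact neg_mem (h3 k i)
  · rw [lie_pt_pt]; exact zero_mem _

variable (n) in
/-- The Lie algebra `L_{n+1} = ∑ F x_i∂_{x_j} + ∑ F ∂_{x_i} + ∑ F p_i ⊆ 𝒲(n)` of the
`n`-dimensional projective group, a copy of `sl(n+1)`. -/
def projLie : LieSubalgebra F (Witt F n) where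
  toSubmodule := Submodule.span F (projGens F n)
  lie_mem' := fun hx hy => span_lie_mem F (projGens_lie_mem F) hx hy

variable (n) in
/-- The abelian Lie algebra `P = ∑ F p_i`. -/
def pseudoTrans : LieSubalgebra F (Witt F n) where
  toSubmodule := Submodule.span F (Set.range (pt F))
  lie_mem' := fun hx hy => span_lie_mem F (by
    rintro _ ⟨i, rfl⟩ _ ⟨j, rfl⟩
    rw [lie_pt_pt]
    exact zero_mem _) hx hy

/-- The positive Chevalley generators `e_i = x_i ∂_{x_{i+1}}` (`i < n`) and `e_n = p_n` of `L_{n+1}`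
(`Fin n` counts from `0`, so that the last index is the one with `i + 1 = n`). -/
def chevE (i : Fin n) : projLie F n :=
  if h : (i : ℕ) + 1 < n then ⟨xpd F i ⟨i + 1, h⟩, xpd_mem_span F _ _⟩
  else ⟨pt F i, pt_mem_span F i⟩

/-- The simple coroots `h_i = x_i ∂_{x_i} - x_{i+1} ∂_{x_{i+1}}` (`i < n`) and
`h_n = ∑ᵣ x_r ∂_{x_r} + x_n ∂_{x_n}`, which form a basis of the Cartan subalgebra. -/
def chevH (i : Fin n) : projLie F n :=
  if h : (i : ℕ) + 1 < n then
    ⟨xpd F i i - xpd F ⟨i + 1, h⟩ ⟨i + 1, h⟩, sub_mem (xpd_mem_span F _ _) (xpd_mem_span F _ _)⟩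
  else ⟨euler F n + xpd F i i, add_mem (euler_mem_span F) (xpd_mem_span F i i)⟩

section Action

variable (V : Type*) [AddCommGroup V] [Module F V]
  [LieRingModule (Gl F n) V] [LieModule F (Gl F n) V]

/-- The operator `∑_{i,j} b_{i,j} ⊗ E_{i,j}` on `𝒜 ⊗ V`, for a matrix `b` over `𝒜`. -/
def matOp (b : Matrix (Fin n) (Fin n) (PolyAlg F n)) :
    Module.End F (PolyAlg F n ⊗[F] V) :=
  ∑ i, ∑ j, TensorProduct.map (LinearMap.mulLeft F (b i j))
    (LieModule.toEnd F (Gl F n) V (E F i j))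

/-- The Jacobian matrix `(∂_i(a_j))_{i,j}` of `D = ∑ a_j ∂_j`. -/
def jac (D : Witt F n) : Matrix (Fin n) (Fin n) (PolyAlg F n) :=
  fun i j => pd F i (D (MvPolynomial.X j))

/-- The operator `π(∑ a_i ∂_i) = ∑_{i,j} ∂_i(a_j) ⊗ E_{i,j} + ∑ a_i ∂_i ⊗ Id_V`. -/
def wittOp (D : Witt F n) : Module.End F (PolyAlg F n ⊗[F] V) :=
  matOp F V (jac F D) + TensorProduct.map (D : PolyAlg F n →ₗ[F] PolyAlg F n) LinearMap.id

theorem matOp_tmul (b : Matrix (Fin n) (Fin n) (PolyAlg F n)) (f : PolyAlg F n) (v : V) :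
    matOp F V b (f ⊗ₜ v) = ∑ i, ∑ j, (b i j * f) ⊗ₜ[F] ⁅E F i j, v⁆ := by
  simp [matOp]

theorem wittOp_tmul (D : Witt F n) (f : PolyAlg F n) (v : V) :
    wittOp F V D (f ⊗ₜ v) =
      ∑ i, ∑ j, (pd F i (D (MvPolynomial.X j)) * f) ⊗ₜ[F] ⁅E F i j, v⁆ + D f ⊗ₜ[F] v := by
  simp [wittOp, matOp_tmul, jac]

theorem E_mul_E (i j k l : Fin n) : E F i j * E F k l = if j = k then E F i l else 0 := by
  split_ifs with h
  · subst h; simp [E]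
  · simp [E, h]

/-- The operators `b ↦ matOp b` form a representation of the matrix Lie algebra over `𝒜`. -/
theorem matOp_matOp (b c : Matrix (Fin n) (Fin n) (PolyAlg F n)) (f : PolyAlg F n) (v : V) :
    matOp F V b (matOp F V c (f ⊗ₜ v)) - matOp F V c (matOp F V b (f ⊗ₜ v)) =
      matOp F V (b * c - c * b) (f ⊗ₜ v) := by
  have key : ∀ i j k l : Fin n, ⁅E F i j, ⁅E F k l, v⁆⁆ - ⁅E F k l, ⁅E F i j, v⁆⁆ =
      (if j = k then ⁅E F i l, v⁆ else 0) - (if l = i then ⁅E F k j, v⁆ else 0) := by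
    intro i j k l
    rw [← lie_lie, LieRing.of_associative_ring_bracket, E_mul_E, E_mul_E, sub_lie]
    split_ifs <;> simp
  have h1 : matOp F V b (matOp F V c (f ⊗ₜ v)) =
      ∑ i, ∑ j, ∑ k, ∑ l, (b i j * c k l * f) ⊗ₜ[F] ⁅E F i j, ⁅E F k l, v⁆⁆ := by
    simp only [matOp_tmul, map_sum]
    rw [Finset.sum_congr rfl fun k _ => Finset.sum_comm, Finset.sum_comm]
    refine Finset.sum_congr rfl fun i _ => ?_
    rw [Finset.sum_congr rfl fun k _ => Finset.sum_comm, Finset.sum_comm]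
    simp only [mul_assoc]
  have h2 : matOp F V c (matOp F V b (f ⊗ₜ v)) =
      ∑ i, ∑ j, ∑ k, ∑ l, (b i j * c k l * f) ⊗ₜ[F] ⁅E F k l, ⁅E F i j, v⁆⁆ := by
    simp only [matOp_tmul, map_sum]
    refine Finset.sum_congr rfl fun i _ => Finset.sum_congr rfl fun j _ =>
      Finset.sum_congr rfl fun k _ => Finset.sum_congr rfl fun l _ => ?_
    congr 1
    ring
  rw [h1, h2]
  simp only [← Finset.sum_sub_distrib, ← TensorProduct.tmul_sub, key]
  simp only [TensorProduct.tmul_sub, Finset.sum_sub_distrib, matOp_tmul, Matrix.sub_apply,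
    sub_mul, TensorProduct.sub_tmul, Matrix.mul_apply, Finset.sum_mul, TensorProduct.sum_tmul]
  congr 1
  · refine Finset.sum_congr rfl fun i _ => ?_
    rw [Finset.sum_comm (f := fun x a => (b i a * c a x * f) ⊗ₜ[F] ⁅E F i x, v⁆)]
    refine Finset.sum_congr rfl fun j _ => ?_
    rw [Finset.sum_comm]
    refine Finset.sum_congr rfl fun l _ => ?_
    rw [Finset.sum_eq_single j (fun k _ hk => by simp [Ne.symm hk]) (by simp)]
    simp
  · have h3 : ∀ i j k : Fin n, (∑ l, (b i j * c k l * f) ⊗ₜ[F]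
        (if l = i then ⁅E F k j, v⁆ else 0)) = (c k i * b i j * f) ⊗ₜ[F] ⁅E F k j, v⁆ := by
      intro i j k
      rw [Finset.sum_eq_single i (fun l _ hl => by simp [hl]) (by simp), if_pos rfl,
        mul_comm (b i j)]
    simp only [h3]
    rw [Finset.sum_congr rfl fun i _ => Finset.sum_comm, Finset.sum_comm]
    exact Finset.sum_congr rfl fun k _ => Finset.sum_comm

theorem matOp_der (D : Witt F n) (b : Matrix (Fin n) (Fin n) (PolyAlg F n))
    (f : PolyAlg F n) (v : V) :
    TensorProduct.map (D : PolyAlg F n →ₗ[F] PolyAlg F n) LinearMap.id (matOp F V b (f ⊗ₜ v)) -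
      matOp F V b (D f ⊗ₜ v) = matOp F V (b.map D) (f ⊗ₜ v) := by
  simp only [matOp_tmul, map_sum, TensorProduct.map_tmul, ← Finset.sum_sub_distrib,
    ← TensorProduct.sub_tmul, LinearMap.id_apply, Matrix.map_apply]
  refine Finset.sum_congr rfl fun i _ => Finset.sum_congr rfl fun j _ => ?_
  congr 1
  simp
  ring

theorem pd_apply_der (D : Witt F n) (g : PolyAlg F n) (i : Fin n) :
    pd F i (D g) = D (pd F i g) + ∑ k, jac F D i k * pd F k g := by
  have h : ⁅pd F i, D⁆ = ∑ k, jac F D i k • pd F k := by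
    apply MvPolynomial.derivation_ext
    intro j
    simp only [Derivation.commutator_apply, sum_apply, pd_X, jac, Derivation.smul_apply]
    split_ifs <;> simp
  have h' := congrArg (fun T : Witt F n => T g) h
  simp only [Derivation.commutator_apply, sum_apply, Derivation.smul_apply, smul_eq_mul] at h'
  rw [← h']
  ring

theorem jac_lie (D D' : Witt F n) :
    jac F ⁅D, D'⁆ = (jac F D').map D - (jac F D).map D' +
      (jac F D * jac F D' - jac F D' * jac F D) := by
  ext1 i j
  simp only [Matrix.add_apply, Matrix.sub_apply, Matrix.map_apply, Matrix.mul_apply]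
  have h : jac F ⁅D, D'⁆ i j = pd F i (D (D' (MvPolynomial.X j))) -
      pd F i (D' (D (MvPolynomial.X j))) := by
    simp [jac, Derivation.commutator_apply]
  rw [h, pd_apply_der F D (D' (MvPolynomial.X j)), pd_apply_der F D' (D (MvPolynomial.X j))]
  simp only [jac]
  ring

theorem matOp_add (b c : Matrix (Fin n) (Fin n) (PolyAlg F n)) :
    matOp F V (b + c) = matOp F V b + matOp F V c := by
  refine TensorProduct.ext' fun f v => ?_
  simp [matOp_tmul, add_mul, TensorProduct.add_tmul, Finset.sum_add_distrib]

theorem matOp_sub (b c : Matrix (Fin n) (Fin n) (PolyAlg F n)) :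
    matOp F V (b - c) = matOp F V b - matOp F V c := by
  refine TensorProduct.ext' fun f v => ?_
  simp [matOp_tmul, sub_mul, TensorProduct.sub_tmul, Finset.sum_sub_distrib]

theorem wittOp_lie (D D' : Witt F n) :
    wittOp F V ⁅D, D'⁆ = ⁅wittOp F V D, wittOp F V D'⁆ := by
  refine TensorProduct.ext' fun f v => ?_
  have h1 := matOp_matOp F V (jac F D) (jac F D') f v
  have h2 := matOp_der F V D (jac F D') f v
  have h3 := matOp_der F V D' (jac F D) f v
  change _ = (wittOp F V D * wittOp F V D' - wittOp F V D' * wittOp F V D) (f ⊗ₜ v)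
  simp only [wittOp, jac_lie, matOp_add, matOp_sub, LinearMap.add_apply, LinearMap.sub_apply,
    Module.End.mul_apply, map_add, TensorProduct.map_tmul, LinearMap.id_apply] at *
  rw [← h1, ← h2, ← h3]
  simp only [Derivation.coeFn_coe, Derivation.commutator_apply, TensorProduct.sub_tmul]
  abel

variable (n) in
/-- Shen's mixed product (Larsson functor): the representation `π` of `𝒲(n)` on `𝒜 ⊗ V`. -/
def wittRep : Witt F n →ₗ⁅F⁆ Module.End F (PolyAlg F n ⊗[F] V) where
  toFun := wittOp F V
  map_add' D D' := by
    refine TensorProduct.ext' fun f v => ?_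
    simp [wittOp_tmul, add_mul, TensorProduct.add_tmul, Finset.sum_add_distrib]
    abel
  map_smul' c D := by
    refine TensorProduct.ext' fun f v => ?_
    simp [wittOp_tmul, Finset.smul_sum, TensorProduct.smul_tmul']
  map_lie' {D D'} := wittOp_lie F V D D'

/-- `𝒜 ⊗ V` is a `𝒲(n)`-module through `π`; hence it is a module over the Lie subalgebras
`L_{n+1}` and `P` of `𝒲(n)` (the generalized projective representation, for `L_{n+1}`). -/
instance : LieRingModule (Witt F n) (PolyAlg F n ⊗[F] V) :=
  LieRingModule.compLieHom _ (wittRep F n V)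

instance : LieModule F (Witt F n) (PolyAlg F n ⊗[F] V) :=
  LieModule.compLieHom _ (wittRep F n V)

variable (n)

/-- `(𝒜 ⊗ V)_⟨k⟩`, spanned by the `x^c ⊗ v` with `|c| = k`. -/
def degAV (k : ℕ) : Submodule F (PolyAlg F n ⊗[F] V) :=
  Submodule.span F {w | ∃ (c : Fin n →₀ ℕ) (v : V), c.degree = k ∧
    w = MvPolynomial.monomial c 1 ⊗ₜ[F] v}

/-- `(U(P)(1 ⊗ V))_⟨k⟩`, spanned by the `p_{i_1} ⋯ p_{i_k} (1 ⊗ v)` with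
`i_1 ≤ ⋯ ≤ i_k`. -/
def degUP (k : ℕ) : Submodule F (PolyAlg F n ⊗[F] V) :=
  Submodule.span F {w | ∃ (i : Fin k → Fin n) (v : V), Monotone i ∧
    w = (List.ofFn fun s => wittRep F n V (pt F (i s))).prod (1 ⊗ₜ[F] v)}

/-- `U(P)(1 ⊗ V)`, the span of the `u (1 ⊗ v)` with `u` in the universal enveloping algebra
of `P` and `v ∈ V`. -/
def UP : Submodule F (PolyAlg F n ⊗[F] V) :=
  Submodule.span F {w | ∃ (u : UniversalEnvelopingAlgebra F (pseudoTrans F n)) (v : V),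
    w = UniversalEnvelopingAlgebra.lift F
      (LieModule.toEnd F (pseudoTrans F n) (PolyAlg F n ⊗[F] V)) u (1 ⊗ₜ[F] v)}

end Action

section Weights

variable {F}

/-- `V` has highest weight `μ = (μ_1, …, μ_n)` as a `gl(n)`-module (used for irreducible
`V`): some nonzero vector of weight `μ` is killed by all `E_{i,j}` with `i < j`. -/
def HasHighestWeight (V : Type*) [AddCommGroup V] [Module F V] [LieRingModule (Gl F n) V]
    (μ : Fin n → F) : Prop :=
  ∃ v : V, v ≠ 0 ∧ (∀ i j : Fin n, i < j → ⁅E F i j, v⁆ = 0) ∧ ∀ i : Fin n, ⁅E F i i, v⁆ = μ i • v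

/-- `N` is a highest weight module for `L_{n+1}`, with respect to the Chevalley generators
above, of highest weight `∑ λ_i ω_i`, where `ω_i(h_j) = δ_{i,j}`: it is generated by a nonzero
vector that is killed by all `e_i` and on which each `h_i` acts as the scalar `λ_i`. -/
def IsHighestWeightModule (N : Type*) [AddCommGroup N] [Module F N]
    [LieRingModule (projLie F n) N] (lam : Fin n → F) : Prop :=
  ∃ v : N, v ≠ 0 ∧ (∀ i : Fin n, ⁅chevE F i, v⁆ = 0) ∧
    (∀ i : Fin n, ⁅chevH F i, v⁆ = lam i • v) ∧
    LieSubmodule.lieSpan F (projLie F n) {v} = ⊤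

variable (F) in
/-- The set `-ℕ ⊆ F`. -/
def negNat : Set F := {x | ∃ m : ℕ, x = -(m : F)}

/-- The set `{a, a + 1, …, b} ⊆ F` for integers `a, b` (empty if `a > b`). -/
def intSeg (a b : F) : Set F :=
  {x | ∃ p q r : ℤ, a = p ∧ b = q ∧ x = r ∧ p ≤ r ∧ r ≤ q}

/-- `μ_1 + |μ| ∉ -ℕ ∪ {2, …, 1 + μ_1 - μ_2}`; the second set is absent if `n = 1`. -/
def CondFirst [NeZero n] (μ : Fin n → F) : Prop :=
  μ 0 + ∑ j, μ j ∉ negNat F ∧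
    ∀ h : 1 < n, μ 0 + ∑ j, μ j ∉ intSeg 2 (1 + (μ 0 - μ ⟨1, h⟩))

/-- `μ_i + |μ| - i ∉ {1, …, μ_i - μ_{i+1}}` for `2 ≤ i ≤ n - 1`. Here `i : Fin n`
stands for the `1`-based index `i + 1`. -/
def CondRest (μ : Fin n → F) : Prop :=
  ∀ (i : Fin n) (h : (i : ℕ) + 1 < n), 1 ≤ (i : ℕ) →
    μ i + ∑ j, μ j - ((i : ℕ) + 1 : F) ∉ intSeg 1 (μ i - μ ⟨i + 1, h⟩)

/-- The weight `k ω_1 + ∑_{i=2}^{n} (μ_{i-1} - μ_i) ω_i` of `L_{n+1}`, by its coefficients. -/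
def topWeight (k : ℕ) (μ : Fin n → F) (i : Fin n) : F :=
  if (i : ℕ) = 0 then (k : F) else μ ⟨(i : ℕ) - 1, by omega⟩ - μ i

end Weights

end GenProj

end

/-! Count indices from 0 and put a_i = μ_i + |μ| - i; dominance makes these numbers strictly
decreasing with integral differences. Let v be the highest weight vector. Modulo images of lowering
operators x_i ∂_l (l < i), the operator p_i sends x^c ⊗ v to a multiple of x^{c+ε_i} ⊗ v
(`wittRep_pt_highest`), and the factor is a_i + c_i when c is supported on indices ≤ i. If the
conditions fail, there is an i₀ with a_{i₀} = -k and a_i ≥ 2 for all i < i₀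
(`exists_critical_index`).

In degrees up to k only factors a_i + s with s < k occur. None vanishes, so every x^c ⊗ V is reached
by induction (`highest_mem_degUP`, `degAV_eq_degUP`). In degree k+1 the factor at x_{i₀}^{k+1} ⊗ v
is zero, and a linear functional that kills images of lowering operators but not this vector
separates the two spaces (`degAV_ne_degUP`). Such a functional exists because the jump from a_{i₀-1}
≥ 2 to -k makes μ + (k+1)ε_{i₀} dominant. To construct it (`exists_lowest_functional`), V is mapped
to polynomials in matrix entries with v going to a product of leading minors, and one pairs under
the Fischer form with the analogous product of weight μ + (k+1)ε_{i₀}, up to a multiple of the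
trace. Partial derivatives carry the inequality to all higher degrees.

U(P)(1 ⊗ V) is irreducible for every μ: partial derivatives bring any nonzero vector down to 1 ⊗ V,
where gl(n) acts irreducibly, and P rebuilds the rest (`isIrreducible_UPLie`). If i₀ = 0, then p_0
is nilpotent on 1 ⊗ V, which forces finite dimension (`finite_UP`), and successive sl(2)-strings
along p_0, …, p_{n-1} lead from 1 ⊗ v to the highest weight vector (`isHighestWeightModule_UPLie`).
Conversely, finite dimension makes the p_0-string through 1 ⊗ v finite, so a_0 ∈ -ℕ
(`exists_nat_of_finite_UP`). -/

noncomputable section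

namespace GenProj

/-! ### Operators with the matrix unit relations and closures under lowering -/

section GlOperators

variable {F : Type*} [Field F] {n : ℕ} {X : Type*} [AddCommGroup X] [Module F X]

/-- A family of operators satisfying the commutation relations of the matrix units. -/
def IsGlFamily (e : Fin n → Fin n → Module.End F X) : Prop :=
  ∀ i j k l x, e i j (e k l x) = e k l (e i j x) +
    ((if j = k then e i l x else 0) - (if l = i then e k j x else 0))

/-- The smallest subspace containing `x` that is stable under the lowering operators. -/
def lowerSpan (e : Fin n → Fin n → Module.End F X) (x : X) : Submodule F X :=
  sInf {S | x ∈ S ∧ ∀ a b, b < a → ∀ y ∈ S, e a b y ∈ S}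

variable {e : Fin n → Fin n → Module.End F X} {x : X}

theorem self_mem_lowerSpan : x ∈ lowerSpan e x :=
  (Submodule.mem_sInf).2 fun _ hS => hS.1

theorem lower_mem_lowerSpan {a b : Fin n} (h : b < a) {y : X} (hy : y ∈ lowerSpan e x) :
    e a b y ∈ lowerSpan e x :=
  (Submodule.mem_sInf).2 fun S hS => hS.2 a b h y ((Submodule.mem_sInf).1 hy S hS)

theorem lowerSpan_le {S : Submodule F X} (hx : x ∈ S)
    (hS : ∀ a b, b < a → ∀ y ∈ S, e a b y ∈ S) : lowerSpan e x ≤ S :=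
  sInf_le ⟨hx, hS⟩

/-- The lowering closure of a highest weight vector is stable under all matrix units. -/
theorem lowerSpan_stable (he : IsGlFamily e) (hr : ∀ i j, i < j → e i j x = 0)
    (hd : ∀ i, ∃ c : F, e i i x = c • x) (p q : Fin n) {y : X} (hy : y ∈ lowerSpan e x) :
    e p q y ∈ lowerSpan e x := by
  let S : Submodule F X :=
    { carrier := {y | y ∈ lowerSpan e x ∧ ∀ p q, e p q y ∈ lowerSpan e x}
      add_mem' := fun ha hb => ⟨add_mem ha.1 hb.1, fun p q => by
        rw [map_add]; exact add_mem (ha.2 p q) (hb.2 p q)⟩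
      zero_mem' := ⟨zero_mem _, fun p q => by rw [map_zero]; exact zero_mem _⟩
      smul_mem' := fun c y hy => ⟨Submodule.smul_mem _ c hy.1, fun p q => by
        rw [map_smul]; exact Submodule.smul_mem _ c (hy.2 p q)⟩ }
  have h : lowerSpan e x ≤ S := by
    refine lowerSpan_le ⟨self_mem_lowerSpan, fun p q => ?_⟩ fun a b hab y hy =>
      ⟨lower_mem_lowerSpan hab hy.1, fun p q => ?_⟩
    · rcases lt_trichotomy p q with h | h | h
      · rw [hr p q h]; exact zero_mem _
      · subst h
        obtain ⟨c, hc⟩ := hd p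
        rw [hc]; exact Submodule.smul_mem _ _ self_mem_lowerSpan
      · exact lower_mem_lowerSpan h self_mem_lowerSpan
    -- Commuting past the lowering operator leaves only matrix units applied to y, which are covered
    -- by y ∈ S.
    · rw [he p q a b y]
      refine add_mem (lower_mem_lowerSpan hab (hy.2 p q)) (sub_mem ?_ ?_) <;> split_ifs
      exacts [hy.2 p b, zero_mem _, hy.2 a q, zero_mem _]
  exact (h hy).2 p q

end GlOperators

/-! ### Highest weight vectors of irreducible gl(n)-modules -/

section HighestWeight

variable {F : Type*} [Field F] {n : ℕ}
  {V : Type*} [AddCommGroup V] [Module F V]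
  [LieRingModule (Gl F n) V] [LieModule F (Gl F n) V]

variable (F V) in
/-- The action of the matrix unit `E_{i,j}` on a `gl(n)`-module. -/
def unitOp (i j : Fin n) : Module.End F V := LieModule.toEnd F (Gl F n) V (E F i j)

theorem unitOp_apply (i j : Fin n) (v : V) : unitOp F V i j v = ⁅E F i j, v⁆ := rfl

theorem lie_E_E (i j k l : Fin n) :
    ⁅E F i j, E F k l⁆ = (if j = k then E F i l else 0) - (if l = i then E F k j else 0) := by
  rw [LieRing.of_associative_ring_bracket, E_mul_E, E_mul_E]

theorem isGlFamily_unitOp : IsGlFamily (unitOp F V (n := n)) := by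
  intro i j k l v
  simp only [unitOp_apply]
  rw [leibniz_lie, lie_E_E, sub_lie, add_comm]
  congr 2 <;> split_ifs <;> simp

/-- The data of a highest weight vector. -/
structure IsHighestVec (μ : Fin n → F) (v : V) : Prop where
  ne_zero : v ≠ 0
  raise : ∀ i j : Fin n, i < j → ⁅E F i j, v⁆ = 0
  diag : ∀ i : Fin n, ⁅E F i i, v⁆ = μ i • v

theorem lowerSpan_eq_top [LieModule.IsIrreducible F (Gl F n) V] {μ : Fin n → F} {v : V}
    (hv : IsHighestVec μ v) : lowerSpan (unitOp F V (n := n)) v = ⊤ := by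
  have hst := fun p q (y : V) (hy : y ∈ lowerSpan (unitOp F V (n := n)) v) =>
    lowerSpan_stable isGlFamily_unitOp hv.raise (fun i => ⟨μ i, hv.diag i⟩) p q hy
  let N : LieSubmodule F (Gl F n) V :=
    { lowerSpan (unitOp F V (n := n)) v with
      lie_mem := by
        intro x m hm
        change ⁅x, m⁆ ∈ lowerSpan (unitOp F V (n := n)) v
        rw [Matrix.matrix_eq_sum_single x, sum_lie]
        refine sum_mem fun i _ => ?_
        rw [sum_lie]
        refine sum_mem fun j _ => ?_
        have : Matrix.single i j (x i j) = x i j • E F i j := by simp [E]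
        rw [this, smul_lie]
        exact Submodule.smul_mem _ _ (hst i j m hm) }
  have hN : N = ⊤ := by
    have : Nontrivial N :=
      ⟨⟨⟨v, self_mem_lowerSpan (e := unitOp F V (n := n))⟩, 0, fun h =>
        hv.ne_zero (congrArg Subtype.val h)⟩⟩
    exact LieSubmodule.eq_top_of_isIrreducible F (Gl F n) V N
  have := congrArg LieSubmodule.toSubmodule hN
  simpa [N] using this

/-- An induction principle: a property of vectors, closed under linear operations and under
lowering, holds everywhere if it holds for the highest weight vector. -/
theorem highest_induction [LieModule.IsIrreducible F (Gl F n) V] {μ : Fin n → F} {v : V}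
    (hv : IsHighestVec μ v) (S : Submodule F V) (h0 : v ∈ S)
    (hS : ∀ a b : Fin n, b < a → ∀ y ∈ S, ⁅E F a b, y⁆ ∈ S) (w : V) : w ∈ S :=
  lowerSpan_le (e := unitOp F V (n := n)) h0 hS (by rw [lowerSpan_eq_top hv]; trivial)

/-- The identity matrix commutes with the lowering operators, so its action is determined on v. This
avoids Schur's lemma, and F need not be algebraically closed. -/
theorem sum_diag_lie [LieModule.IsIrreducible F (Gl F n) V] {μ : Fin n → F} {v : V}
    (hv : IsHighestVec μ v) (w : V) : ∑ j : Fin n, ⁅E F j j, w⁆ = (∑ j, μ j) • w := by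
  let f : Module.End F V := ∑ j : Fin n, unitOp F V j j - (∑ j, μ j) • LinearMap.id
  have hf : ∀ w, f w = ∑ j : Fin n, ⁅E F j j, w⁆ - (∑ j, μ j) • w := fun w => by
    simp [f, unitOp_apply]
  have h : w ∈ LinearMap.ker f := by
    refine highest_induction hv (LinearMap.ker f) ?_ (fun a b _ y hy => ?_) w
    · rw [LinearMap.mem_ker, hf, Finset.sum_congr rfl fun j _ => hv.diag j, Finset.sum_smul,
        sub_self]
    · rw [LinearMap.mem_ker, hf] at hy ⊢
      have h1 : ∀ j : Fin n, ⁅E F j j, ⁅E F a b, y⁆⁆ = ⁅E F a b, ⁅E F j j, y⁆⁆ +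
          ((if j = a then ⁅E F a b, y⁆ else 0) - (if j = b then ⁅E F a b, y⁆ else 0)) := by
        intro j
        have := isGlFamily_unitOp (F := F) (V := V) j j a b y
        simp only [unitOp_apply] at this
        rw [this]
        congr 2
        · split_ifs with h
          · rw [h]
          · rfl
        · by_cases h : j = b
          · simp [h]
          · simp [h, Ne.symm h]
      have h2 := congrArg (fun z => ⁅E F a b, z⁆) hy
      simp only [lie_sub, lie_zero, lie_smul, lie_sum] at h2
      simp only [h1, Finset.sum_add_distrib, Finset.sum_sub_distrib]
      simpa using h2
  rw [LinearMap.mem_ker, hf] at h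
  exact sub_eq_zero.1 h

variable [CharZero F]

/-- v is primitive for the sl(2)-triple of the root ε_i - ε_j, and V is finite-dimensional. -/
theorem exists_nat_sub [Module.Finite F V] {μ : Fin n → F} {v : V}
    (hv : IsHighestVec μ v) {i j : Fin n} (h : i < j) : ∃ N : ℕ, μ i - μ j = N := by
  have hij : i ≠ j := h.ne
  have t : IsSl2Triple (E F i i - E F j j) (E F i j) (E F j i) := by
    refine ⟨fun h0 => ?_, ?_, ?_, ?_⟩
    · have := congrFun (congrFun h0 i) i
      simp [E, hij.symm] at this
    · simp [lie_E_E]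
    · simp [lie_E_E, hij.symm, two_smul]
    · simp [lie_E_E, hij, two_smul]
      abel
  have P : t.HasPrimitiveVectorWith v (μ i - μ j) :=
    ⟨hv.ne_zero, by rw [sub_lie, hv.diag, hv.diag, sub_smul], hv.raise i j h⟩
  exact P.exists_nat

/-- The linear functional dual to the highest weight vector. -/
theorem exists_highest_functional [LieModule.IsIrreducible F (Gl F n) V] {μ : Fin n → F} {v : V}
    (hv : IsHighestVec μ v) :
    ∃ ξ : V →ₗ[F] F, ξ v = 1 ∧ ∀ a b : Fin n, b < a → ∀ y, ξ ⁅E F a b, y⁆ = 0 := by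
  -- H is a grading element: E_{a,b} shifts its eigenvalues by a - b, so lowering moves strictly
  -- upwards from θ, the eigenvalue of v.
  let H : Module.End F V := ∑ l : Fin n, ((l : ℕ) : F) • unitOp F V l l
  set θ : F := ∑ l : Fin n, ((l : ℕ) : F) * μ l with hθ
  have hHv : H v = θ • v := by
    simp [H, unitOp_apply, hv.diag, hθ, Finset.sum_smul, mul_smul]
  have hcomm : ∀ (a b : Fin n) y, H ⁅E F a b, y⁆ =
      ⁅E F a b, H y⁆ + (((a : ℕ) : F) - (b : ℕ)) • ⁅E F a b, y⁆ := by
    intro a b y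
    have h1 : ∀ j : Fin n, ⁅E F j j, ⁅E F a b, y⁆⁆ = ⁅E F a b, ⁅E F j j, y⁆⁆ +
        ((if j = a then ⁅E F a b, y⁆ else 0) - (if j = b then ⁅E F a b, y⁆ else 0)) := by
      intro j
      have := isGlFamily_unitOp (F := F) (V := V) j j a b y
      simp only [unitOp_apply] at this
      rw [this]
      congr 2
      · split_ifs with h
        · rw [h]
        · rfl
      · by_cases h : j = b
        · simp [h]
        · simp [h, Ne.symm h]
    simp only [H, LinearMap.sum_apply, LinearMap.smul_apply, unitOp_apply, h1, smul_add, smul_sub,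
      Finset.sum_add_distrib, Finset.sum_sub_distrib, lie_sum, lie_smul, smul_ite, smul_zero,
      Finset.sum_ite_eq', Finset.mem_univ, if_true, sub_smul]
  let K : Submodule F V := ⨆ m : ℕ, H.eigenspace (θ + ((m : F) + 1))
  have hlow : ∀ a b : Fin n, b < a → ∀ m : ℕ, ∀ y ∈ H.eigenspace (θ + (m : F)),
      ⁅E F a b, y⁆ ∈ K := by
    intro a b hab m y hy
    rw [Module.End.mem_eigenspace_iff] at hy
    have hlt : (b : ℕ) < a := hab
    -- The summands of K start at θ + 1, hence the shift by one; b < a makes the truncated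
    -- subtraction exact.
    refine Submodule.mem_iSup_of_mem (m + (a - b - 1)) ?_
    rw [Module.End.mem_eigenspace_iff, hcomm, hy, lie_smul, ← add_smul]
    congr 1
    have : ((m + ((a : ℕ) - b - 1) : ℕ) : F) + 1 = m + ((a : ℕ) - (b : ℕ)) := by
      have h2 : (m + ((a : ℕ) - b - 1)) + 1 + (b : ℕ) = m + a := by omega
      have := congrArg (Nat.cast : ℕ → F) h2
      push_cast at this ⊢
      linear_combination this
    rw [this]; ring
  have hKlow : ∀ a b : Fin n, b < a → ∀ y ∈ K, ⁅E F a b, y⁆ ∈ K := by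
    intro a b hab y hy
    induction hy using Submodule.iSup_induction' with
    | mem m y hy =>
      refine hlow a b hab (m + 1) y ?_
      simpa using hy
    | zero => simp
    | add y z _ _ h1 h2 => rw [lie_add]; exact add_mem h1 h2
  have hvK : v ∉ K := by
    intro h
    have hd := (Module.End.eigenspaces_iSupIndep H) θ
    have hK : K ≤ ⨆ j, ⨆ (_ : j ≠ θ), H.eigenspace j := by
      refine iSup_le fun m => ?_
      refine le_iSup₂_of_le (θ + ((m : F) + 1)) ?_ le_rfl
      intro h
      have : ((m + 1 : ℕ) : F) = 0 := by push_cast; linear_combination h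
      exact absurd (Nat.cast_eq_zero.1 this) (by omega)
    exact hv.ne_zero (Submodule.disjoint_def.1 hd v
      (Module.End.mem_eigenspace_iff.2 hHv) (hK h))
  obtain ⟨ξ, hξ, hξK⟩ := Submodule.exists_le_ker_of_notMem hvK
  refine ⟨(ξ v)⁻¹ • ξ, by simp [hξ], fun a b hab y => ?_⟩
  -- V = F v + K, and lowering maps both summands into K, on which ξ vanishes.
  have hy : y ∈ Submodule.span F {v} ⊔ K := by
    refine highest_induction hv _ ?_ ?_ y
    · exact Submodule.mem_sup_left (Submodule.mem_span_singleton_self v)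
    · intro a b hab z hz
      refine Submodule.mem_sup_right ?_
      obtain ⟨z1, h1, z2, h2, rfl⟩ := Submodule.mem_sup.1 hz
      obtain ⟨c, rfl⟩ := Submodule.mem_span_singleton.1 h1
      rw [lie_add, lie_smul]
      refine add_mem (Submodule.smul_mem _ _ (hlow a b hab 0 v ?_)) (hKlow a b hab z2 h2)
      simpa using Module.End.mem_eigenspace_iff.2 hHv
  obtain ⟨z1, h1, z2, h2, rfl⟩ := Submodule.mem_sup.1 hy
  obtain ⟨c, rfl⟩ := Submodule.mem_span_singleton.1 h1
  have : ⁅E F a b, c • v + z2⁆ ∈ K := by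
    rw [lie_add, lie_smul]
    refine add_mem (Submodule.smul_mem _ _ (hlow a b hab 0 v ?_)) (hKlow a b hab z2 h2)
    simpa using Module.End.mem_eigenspace_iff.2 hHv
  have h0 := LinearMap.mem_ker.1 (hξK this)
  rw [LinearMap.smul_apply, h0, smul_zero]

end HighestWeight

/-! ### The Fischer inner product on polynomials -/

section Fischer

open MvPolynomial

variable {σ : Type*}

/-- The factorial of a multi-index. -/
def multiFact (c : σ →₀ ℕ) : ℕ := c.prod fun _ m => m.factorial

theorem multiFact_ne_zero (c : σ →₀ ℕ) : multiFact c ≠ 0 :=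
  Finset.prod_ne_zero_iff.2 fun _ _ => Nat.factorial_ne_zero _

theorem multiFact_add_single (c : σ →₀ ℕ) (v : σ) :
    multiFact (c + Finsupp.single v 1) = (c v + 1) * multiFact c := by
  classical
  have h1 : ∀ d : σ →₀ ℕ, multiFact d = (d v).factorial * multiFact (d.erase v) := by
    intro d
    rw [multiFact, multiFact]
    by_cases h : v ∈ d.support
    · exact (Finsupp.mul_prod_erase d v _ h).symm
    · rw [Finsupp.erase_of_notMem_support h]
      simp [Finsupp.notMem_support_iff.1 h]
  rw [h1 (c + _), h1 c]
  simp [Finsupp.erase_add, Nat.factorial_succ, mul_assoc]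

variable (K : Type*) [Field K]

variable (σ) in
/-- The Fischer form: distinct monomials are orthogonal and `⟨x^c, x^c⟩ = c!`. -/
def fischer : MvPolynomial σ K →ₗ[K] MvPolynomial σ K →ₗ[K] K :=
  (basisMonomials σ K).constr K fun c => (multiFact c : K) • lcoeff K c

variable {K}

theorem fischer_monomial (c : σ →₀ ℕ) (q : MvPolynomial σ K) :
    fischer σ K (monomial c 1) q = multiFact c * coeff c q := by
  have : (monomial c 1 : MvPolynomial σ K) = basisMonomials σ K c := by simp
  rw [fischer, this, Module.Basis.constr_basis]
  simp

theorem monomial_eq_smul_one (c : σ →₀ ℕ) (a : K) :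
    (monomial c a : MvPolynomial σ K) = a • monomial c 1 := by
  rw [smul_monomial, smul_eq_mul, mul_one]

theorem fischer_symm (p q : MvPolynomial σ K) : fischer σ K p q = fischer σ K q p := by
  classical
  induction p using MvPolynomial.induction_on' with
  | add p p' h h' => simp [h, h']
  | monomial c a =>
    induction q using MvPolynomial.induction_on' with
    | add p p' h h' => rw [map_add, map_add, LinearMap.add_apply, h, h']
    | monomial d b =>
      rw [monomial_eq_smul_one, monomial_eq_smul_one d]
      simp only [map_smul, LinearMap.smul_apply, fischer_monomial, coeff_monomial]
      by_cases h : c = d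
      · subst h; simp; ring
      · simp [h, Ne.symm h]

/-- Multiplication by a variable is adjoint to the partial derivative. -/
theorem fischer_X_mul (v : σ) (p q : MvPolynomial σ K) :
    fischer σ K (X v * p) q = fischer σ K p (pderiv v q) := by
  induction p using MvPolynomial.induction_on' with
  | add p p' h h' => rw [mul_add, map_add, map_add, LinearMap.add_apply, LinearMap.add_apply, h, h']
  | monomial c a =>
    have : X v * (monomial c 1 : MvPolynomial σ K) = monomial (c + Finsupp.single v 1) 1 := by
      rw [mul_comm, monomial_add_single, pow_one]
    rw [monomial_eq_smul_one, mul_smul_comm, this]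
    simp only [map_smul, LinearMap.smul_apply, fischer_monomial, coeff_pderiv,
      multiFact_add_single]
    push_cast
    ring_nf

theorem fischer_pderiv (v : σ) (p q : MvPolynomial σ K) :
    fischer σ K (pderiv v p) q = fischer σ K p (X v * q) := by
  rw [fischer_symm, ← fischer_X_mul, fischer_symm]

theorem fischer_eq_sum (p q : MvPolynomial σ K) :
    fischer σ K p q = ∑ c ∈ p.support, coeff c p * (multiFact c * coeff c q) := by
  conv_lhs => rw [p.as_sum]
  simp only [map_sum, LinearMap.sum_apply]
  refine Finset.sum_congr rfl fun c _ => ?_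
  rw [monomial_eq_smul_one, map_smul, LinearMap.smul_apply, fischer_monomial, smul_eq_mul]

/-- Over ℚ the value is a sum of squares with positive weights c!. Over a general F isotropic
vectors can exist, which is why rational structures are used below. -/
theorem eq_zero_of_fischer_self {p : MvPolynomial σ ℚ} (h : fischer σ ℚ p p = 0) : p = 0 := by
  rw [fischer_eq_sum] at h
  have h0 : ∀ c ∈ p.support, 0 ≤ coeff c p * (multiFact c * coeff c p) := fun c _ => by
    have : coeff c p * (multiFact c * coeff c p) = multiFact c * coeff c p ^ 2 := by ring
    rw [this]; positivity
  rw [Finset.sum_eq_zero_iff_of_nonneg h0] at h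
  by_contra hp
  obtain ⟨c, hc⟩ := support_nonempty.2 hp
  have h1 := h c hc
  have h2 := mem_support_iff.1 hc
  have h3 : (multiFact c : ℚ) ≠ 0 := Nat.cast_ne_zero.2 (multiFact_ne_zero c)
  simp [h2, h3] at h1

/-- Apply an additive map to all coefficients of a polynomial. -/
def coeffMap {F : Type*} [Field F] (π : F →+ K) (p : MvPolynomial σ F) : MvPolynomial σ K :=
  ∑ c ∈ p.support, monomial c (π (coeff c p))

theorem coeff_coeffMap {F : Type*} [Field F] (π : F →+ K) (p : MvPolynomial σ F) (c : σ →₀ ℕ) :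
    coeff c (coeffMap π p) = π (coeff c p) := by
  classical
  simp only [coeffMap, coeff_sum, coeff_monomial]
  rw [Finset.sum_ite_eq' p.support c]
  split_ifs with h
  · rfl
  · rw [notMem_support_iff.1 h, map_zero]

end Fischer

/-! ### Polarization operators on polynomials in matrix entries -/

section Polarization

open MvPolynomial

variable {n : ℕ} (K : Type*) [Field K]

/-- Polynomials in the entries of an `n × n` matrix together with one further column. -/
abbrev MatPoly (n : ℕ) (K : Type*) [Field K] := MvPolynomial (Fin n × Option (Fin n)) K

/-- The polarization operator `∑ₛ y_{a,s} ∂_{b,s}`. -/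
def polar (a b : Fin n) : Derivation K (MatPoly n K) (MatPoly n K) :=
  ∑ s, (X (a, s) : MatPoly n K) • pderiv (b, s)

variable {K}

theorem polar_apply (a b : Fin n) (p : MatPoly n K) :
    polar K a b p = ∑ s, X (a, s) * pderiv (b, s) p := by
  have h := map_sum (Derivation.coeFnAddMonoidHom (R := K) (A := MatPoly n K) (M := MatPoly n K))
    (fun s => (X (a, s) : MatPoly n K) • pderiv (b, s)) Finset.univ
  have h' := congrFun h p
  rw [Finset.sum_apply] at h'
  exact h'

variable (K) in
/-- The polarization operators as linear endomorphisms. -/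
def polarOp (a b : Fin n) : Module.End K (MatPoly n K) :=
  (polar K a b : MatPoly n K →ₗ[K] MatPoly n K)

theorem polar_X (a b c : Fin n) (s : Option (Fin n)) :
    polar K a b (X (c, s)) = if b = c then X (a, s) else 0 := by
  classical
  rw [polar_apply]
  by_cases h : b = c
  · subst h
    simp [pderiv_X, Pi.single_apply]
  · simp [pderiv_X, h, Ne.symm h]

/-- Adjointness of multiplication and differentiation makes the form contravariant: raising and
lowering operators are adjoint to each other. -/
theorem fischer_polar (a b : Fin n) (p q : MatPoly n K) :
    fischer _ K (polar K a b p) q = fischer _ K p (polar K b a q) := by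
  simp only [polar_apply, map_sum, LinearMap.sum_apply, fischer_X_mul, fischer_pderiv]

theorem polar_comm (i j k l : Fin n) (p : MatPoly n K) :
    polar K i j (polar K k l p) = polar K k l (polar K i j p) +
      ((if j = k then polar K i l p else 0) - (if l = i then polar K k j p else 0)) := by
  have h : ⁅polar K i j, polar K k l⁆ =
      (if j = k then polar K i l else 0) - (if l = i then polar K k j else 0) := by
    apply derivation_ext
    rintro ⟨c, s⟩
    simp only [Derivation.commutator_apply, polar_X]
    split_ifs <;> simp_all [polar_X]
  have h' := congrArg (fun T : Derivation K (MatPoly n K) (MatPoly n K) => T p) h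
  simp only [Derivation.commutator_apply, Derivation.sub_apply] at h'
  rw [sub_eq_iff_eq_add'] at h'
  rw [h']
  congr 2 <;> split_ifs <;> rfl

/-- Polarizations have integer structure constants, so they commute with ℚ-linear maps applied
coefficientwise. -/
theorem coeffMap_polar {F : Type*} [Field F] [CharZero F] (π : F →ₗ[ℚ] ℚ) (a b : Fin n)
    (p : MatPoly n F) :
    coeffMap π.toAddMonoidHom (polar F a b p) = polar ℚ a b (coeffMap π.toAddMonoidHom p) := by
  classical
  ext c
  have hπ : ∀ (x : F) (m : ℕ), π (x * (m + 1)) = π x * (m + 1) := by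
    intro x m
    have : x * (m + 1) = ((m + 1 : ℕ) : ℚ) • x := by
      rw [Rat.smul_def]; push_cast; ring
    rw [this, map_smul]
    push_cast
    rw [smul_eq_mul]; ring
  simp only [coeff_coeffMap, polar_apply, coeff_sum, coeff_X_mul', coeff_pderiv,
    map_sum, LinearMap.toAddMonoidHom_coe]
  refine Finset.sum_congr rfl fun s _ => ?_
  split_ifs
  · exact hπ _ _
  · exact map_zero π

theorem map_polar {F : Type*} [Field F] [CharZero F] (a b : Fin n) (p : MatPoly n ℚ) :
    map (algebraMap ℚ F) (polar ℚ a b p) = polar F a b (map (algebraMap ℚ F) p) := by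
  simp only [polar_apply, map_sum, map_mul, map_X, pderiv_map]

end Polarization

/-! ### Derivations applied to products and determinants -/

section DerivationDet

theorem derivation_prod {R A : Type*} [CommRing R] [CommRing A] [Algebra R A]
    (D : Derivation R A A) {ι : Type*} [DecidableEq ι] (s : Finset ι) (f : ι → A) :
    D (∏ i ∈ s, f i) = ∑ i ∈ s, (∏ j ∈ s.erase i, f j) * D (f i) := by
  induction s using Finset.induction_on with
  | empty => simp
  | insert a s ha ih =>
    rw [Finset.prod_insert ha, D.leibniz, ih, Finset.sum_insert ha, Finset.erase_insert ha,
      smul_eq_mul, smul_eq_mul, Finset.mul_sum, add_comm]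
    congr 1
    refine Finset.sum_congr rfl fun i hi => ?_
    have hia : a ≠ i := fun h => ha (h ▸ hi)
    rw [Finset.erase_insert_of_ne hia, Finset.prod_insert (fun h => ha (Finset.mem_of_mem_erase h))]
    ring

/-- A derivation differentiates a determinant row by row. -/
theorem derivation_det {R A : Type*} [CommRing R] [CommRing A] [Algebra R A]
    (D : Derivation R A A) {ι : Type*} [DecidableEq ι] [Fintype ι] (M : Matrix ι ι A) :
    D M.det = ∑ a, (M.updateRow a fun b => D (M a b)).det := by
  -- The Leibniz expansion is taken with one factor per row, so that differentiating factor a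
  -- changes row a.
  have hdet : ∀ N : Matrix ι ι A, N.det =
      ∑ τ : Equiv.Perm ι, ((Equiv.Perm.sign τ : ℤ) : A) * ∏ i, N i (τ i) := by
    intro N
    rw [← Matrix.det_transpose, Matrix.det_apply']
    rfl
  rw [hdet M, map_sum]
  simp only [hdet (Matrix.updateRow _ _ _)]
  rw [Finset.sum_comm]
  refine Finset.sum_congr rfl fun τ _ => ?_
  rw [D.leibniz, D.map_intCast, smul_zero, add_zero, derivation_prod, smul_eq_mul, Finset.mul_sum]
  refine Finset.sum_congr rfl fun a _ => ?_
  congr 1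
  rw [← Finset.mul_prod_erase Finset.univ _ (Finset.mem_univ a), Matrix.updateRow_self, mul_comm]
  congr 1
  refine Finset.prod_congr rfl fun i hi => ?_
  rw [Matrix.updateRow_ne (Finset.ne_of_mem_erase hi)]

end DerivationDet

/-! ### Products of leading minors as highest weight vectors -/

section Flags

open MvPolynomial

variable {n : ℕ} (K : Type*) [Field K]

/-- The matrix whose first `r` rows are generic, with columns chosen by `τ`, and whose other
rows are those of the identity matrix. -/
def flagMat (r : ℕ) (τ : Fin n → Option (Fin n)) : Matrix (Fin n) (Fin n) (MatPoly n K) :=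
  fun a b => if (a : ℕ) < r then X (a, τ b) else if a = b then 1 else 0

/-- The minor formed by the first `r` rows. -/
def flagMinor (r : ℕ) (τ : Fin n → Option (Fin n)) : MatPoly n K := (flagMat K r τ).det

variable {K}

/-- Only row d contains variables with first index d, and only if it is one of the generic rows; the
polarization turns it into a copy of row c. -/
theorem polar_flagMinor (c d : Fin n) (r : ℕ) (τ : Fin n → Option (Fin n)) :
    polar K c d (flagMinor K r τ) = if (d : ℕ) < r then
      ((flagMat K r τ).updateRow d fun b => X (c, τ b)).det else 0 := by
  have key : ∀ a b, polar K c d (flagMat K r τ a b) =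
      if (a : ℕ) < r ∧ d = a then X (c, τ b) else 0 := by
    intro a b
    rw [flagMat]
    by_cases h : (a : ℕ) < r
    · simp [h, polar_X]
    · have h2 : ¬ ((a : ℕ) < r ∧ d = a) := fun h' => h h'.1
      rw [if_neg h, if_neg h2]
      split_ifs <;> simp
  rw [flagMinor, derivation_det]
  simp only [key]
  split_ifs with h
  · rw [Finset.sum_eq_single d]
    · simp [h]
    · intro a _ ha
      refine Matrix.det_eq_zero_of_row_eq_zero a fun b => ?_
      simp [Ne.symm ha]
    · simp
  · refine Finset.sum_eq_zero fun a _ => Matrix.det_eq_zero_of_row_eq_zero a fun b => ?_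
    have : ¬ ((a : ℕ) < r ∧ d = a) := by rintro ⟨h1, rfl⟩; exact h h1
    simp [this]

/-- If row d is generic, so is the earlier row c, and the polarized determinant has two equal rows.
-/
theorem polar_flagMinor_raise {c d : Fin n} (h : c < d) (r : ℕ) (τ : Fin n → Option (Fin n)) :
    polar K c d (flagMinor K r τ) = 0 := by
  rw [polar_flagMinor]
  split_ifs with hd
  · refine Matrix.det_zero_of_row_eq h.ne ?_
    funext b
    have hc : (c : ℕ) < r := lt_trans h hd
    rw [Matrix.updateRow_self, Matrix.updateRow_ne h.ne, flagMat, if_pos hc]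
  · rfl

theorem polar_flagMinor_diag (c : Fin n) (r : ℕ) (τ : Fin n → Option (Fin n)) :
    polar K c c (flagMinor K r τ) = ((if (c : ℕ) < r then 1 else 0 : ℕ) : K) • flagMinor K r τ := by
  rw [polar_flagMinor]
  split_ifs with h
  · have : (flagMat K r τ).updateRow c (fun b => X (c, τ b)) = flagMat K r τ := by
      ext1 a b
      by_cases ha : a = c
      · subst ha; simp [flagMat, h]
      · rw [Matrix.updateRow_ne ha]
    rw [this, flagMinor]
    simp
  · simp

theorem map_flagMinor {F : Type*} [Field F] (φ : K →+* F) (r : ℕ) (τ : Fin n → Option (Fin n)) :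
    map φ (flagMinor K r τ) = flagMinor F r τ := by
  rw [flagMinor, RingHom.map_det, flagMinor]
  congr 1
  ext1 a b
  simp only [RingHom.mapMatrix_apply, Matrix.map_apply, flagMat]
  split_ifs <;> simp

theorem flagMinor_zero (τ : Fin n → Option (Fin n)) : flagMinor K 0 τ = 1 := by
  have : flagMat K 0 τ = 1 := by
    ext1 a b
    simp [flagMat, Matrix.one_apply]
  rw [flagMinor, this, Matrix.det_one]

/-- Specializing the generic matrix to the identity gives the value 1. -/
theorem flagMinor_some_ne_zero (r : ℕ) : flagMinor K r (some : Fin n → Option (Fin n)) ≠ 0 := by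
  intro h
  let φ : MatPoly n K →+* K := (aeval fun v : Fin n × Option (Fin n) =>
    if some v.1 = v.2 then (1 : K) else 0 : MatPoly n K →ₐ[K] K).toRingHom
  have h1 := congrArg φ h
  rw [flagMinor, RingHom.map_det, map_zero] at h1
  have : φ.mapMatrix (flagMat K r (some : Fin n → Option (Fin n))) = 1 := by
    ext1 a b
    simp only [RingHom.mapMatrix_apply, Matrix.map_apply, flagMat, Matrix.one_apply]
    split_ifs <;> simp_all [φ]
  rw [this, Matrix.det_one] at h1
  exact one_ne_zero h1

theorem pderiv_none_flagMinor_some (c : Fin n) (r : ℕ) :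
    pderiv (c, none) (flagMinor K r (some : Fin n → Option (Fin n))) = 0 := by
  rw [flagMinor, derivation_det]
  refine Finset.sum_eq_zero fun a _ => Matrix.det_eq_zero_of_row_eq_zero a fun b => ?_
  rw [Matrix.updateRow_self, flagMat]
  split_ifs
  · exact pderiv_X_of_ne (by simp)
  · exact pderiv_one
  · exact map_zero _

variable (K) in
/-- The leading minor of size `i + 1`, with the last column replaced by the additional one. -/
def markedMinor (i : Fin n) : MatPoly n K := flagMinor K (i + 1) (Function.update some i none)

theorem pderiv_none_markedMinor (i : Fin n) :
    pderiv (i, none) (markedMinor K i) = flagMinor K i some := by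
  classical
  have key : ∀ a b, pderiv (i, none) (flagMat K (i + 1) (Function.update some i none) a b) =
      if a = i ∧ b = i then 1 else 0 := by
    intro a b
    rw [flagMat]
    by_cases hb : b = i
    · subst hb
      by_cases ha : a = b
      · subst ha; simp
      · split_ifs <;> simp_all [pderiv_X]
    · split_ifs <;> simp_all [pderiv_X]
  rw [markedMinor, flagMinor, derivation_det]
  simp only [key]
  rw [Finset.sum_eq_single i]
  · rw [flagMinor]
    symm
    -- After differentiation row i is a unit vector. Adding multiples of it to the rows above
    -- exchanges the extra column for the original column i.
    refine Matrix.det_eq_of_forall_row_eq_smul_add_const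
      (fun a => if (a : ℕ) < i then X (a, some i) - X (a, none) else 0) i (by simp) ?_
    intro a b
    rw [Matrix.updateRow_self]
    rcases lt_trichotomy a i with h | h | h
    · have h' : (a : ℕ) < i := h
      rw [Matrix.updateRow_ne h.ne, flagMat, flagMat, if_pos h',
        if_pos (h'.trans (Nat.lt_succ_self _)),
        if_pos h']
      by_cases hb : b = i
      · subst hb; simp
      · simp [hb]
    · subst h
      simp [flagMat, eq_comm]
    · have h' : ¬ (a : ℕ) < i := not_lt.2 (le_of_lt h)
      have h'' : ¬ (a : ℕ) < i + 1 := not_lt.2 (Nat.succ_le_of_lt h)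
      rw [Matrix.updateRow_ne h.ne', flagMat, flagMat, if_neg h', if_neg h', if_neg h'']
      simp
  · intro a _ ha
    refine Matrix.det_eq_zero_of_row_eq_zero a fun b => ?_
    simp [ha]
  · simp

variable (K) in
/-- A product of powers of leading minors. -/
def flagProd (N : Fin n → ℕ) : MatPoly n K := ∏ r : Fin n, flagMinor K (r + 1) some ^ N r

/-- The polynomial `p` is a highest weight vector of weight `w` for the polarization operators. -/
structure IsPolarHighest (w : Fin n → ℕ) (p : MatPoly n K) : Prop where
  raise : ∀ c d : Fin n, c < d → polar K c d p = 0
  diag : ∀ c : Fin n, polar K c c p = (w c : K) • p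

theorem IsPolarHighest.mul {w w' : Fin n → ℕ} {p p' : MatPoly n K} (h : IsPolarHighest w p)
    (h' : IsPolarHighest w' p') : IsPolarHighest (w + w') (p * p') where
  raise c d hcd := by rw [Derivation.leibniz, h.raise c d hcd, h'.raise c d hcd]; simp
  diag c := by
    rw [Derivation.leibniz, h.diag, h'.diag, Pi.add_apply, Nat.cast_add, add_smul]
    simp only [smul_eq_mul, mul_smul_comm, mul_comm p' p]
    abel

theorem isPolarHighest_one : IsPolarHighest (0 : Fin n → ℕ) (1 : MatPoly n K) where
  raise c d _ := by simp
  diag c := by simp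

theorem IsPolarHighest.pow {w : Fin n → ℕ} {p : MatPoly n K} (h : IsPolarHighest w p) (m : ℕ) :
    IsPolarHighest (m • w) (p ^ m) := by
  induction m with
  | zero => simpa using isPolarHighest_one
  | succ m ih => rw [pow_succ, succ_nsmul]; exact ih.mul h

theorem isPolarHighest_prod {ι : Type*} (s : Finset ι) (w : ι → Fin n → ℕ) (p : ι → MatPoly n K)
    (h : ∀ i ∈ s, IsPolarHighest (w i) (p i)) :
    IsPolarHighest (∑ i ∈ s, w i) (∏ i ∈ s, p i) := by
  classical
  induction s using Finset.induction_on with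
  | empty => simpa using isPolarHighest_one
  | insert a s ha ih =>
    rw [Finset.sum_insert ha, Finset.prod_insert ha]
    exact (h a (Finset.mem_insert_self a s)).mul (ih fun i hi => h i (Finset.mem_insert_of_mem hi))

theorem isPolarHighest_flagMinor (r : ℕ) (τ : Fin n → Option (Fin n)) :
    IsPolarHighest (fun c => if (c : ℕ) < r then 1 else 0) (flagMinor K r τ) where
  raise _ _ h := polar_flagMinor_raise h r τ
  diag c := polar_flagMinor_diag c r τ

theorem isPolarHighest_flagProd (N : Fin n → ℕ) :
    IsPolarHighest (∑ r : Fin n, N r • fun c : Fin n => if (c : ℕ) < r + 1 then 1 else 0)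
      (flagProd K N) :=
  isPolarHighest_prod _ _ _ fun r _ => (isPolarHighest_flagMinor (r + 1) some).pow (N r)

theorem map_flagProd {F : Type*} [Field F] (φ : K →+* F) (N : Fin n → ℕ) :
    map φ (flagProd K N) = flagProd F N := by
  simp only [flagProd, map_prod, map_pow, map_flagMinor]

theorem flagProd_ne_zero (N : Fin n → ℕ) : flagProd K N ≠ 0 :=
  Finset.prod_ne_zero_iff.2 fun _ _ => pow_ne_zero _ (flagMinor_some_ne_zero _)

theorem pderiv_none_flagProd (c : Fin n) (N : Fin n → ℕ) :
    pderiv (c, none) (flagProd K N) = 0 := by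
  rw [flagProd, derivation_prod]
  refine Finset.sum_eq_zero fun r _ => ?_
  rw [Derivation.leibniz_pow, pderiv_none_flagMinor_some, smul_zero, smul_zero, mul_zero]

/-- The minor of size i is the factor with index i - 1, so J copies can be split off. -/
theorem exists_flagProd_eq (N : Fin n → ℕ) (i : Fin n) (J : ℕ)
    (h : ∀ r : Fin n, (r : ℕ) + 1 = i → J ≤ N r) :
    ∃ N' : Fin n → ℕ, flagProd K N = flagProd K N' * flagMinor K i some ^ J := by
  classical
  by_cases hi : (i : ℕ) = 0
  -- For i = 0 the empty minor is 1 and no condition on J is needed.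
  · exact ⟨N, by rw [hi, flagMinor_zero, one_pow, mul_one]⟩
  · let r : Fin n := ⟨i - 1, by omega⟩
    have hr : (r : ℕ) + 1 = i := Nat.sub_add_cancel (Nat.pos_of_ne_zero hi)
    refine ⟨Function.update N r (N r - J), ?_⟩
    have h1 : (∏ s ∈ Finset.univ.erase r, flagMinor K (s + 1) some ^
          Function.update N r (N r - J) s : MatPoly n K) =
        ∏ s ∈ Finset.univ.erase r, flagMinor K (s + 1) some ^ N s :=
      Finset.prod_congr rfl fun s hs => by rw [Function.update_of_ne (Finset.ne_of_mem_erase hs)]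
    rw [flagProd, flagProd, ← Finset.mul_prod_erase _ _ (Finset.mem_univ r),
      ← Finset.mul_prod_erase Finset.univ (fun s : Fin n => flagMinor K (s + 1) some ^ _)
        (Finset.mem_univ r), h1, Function.update_self, ← hr]
    have h2 : N r = N r - J + J := (Nat.sub_add_cancel (h r hr)).symm
    conv_lhs => rw [h2, pow_add]
    ring

/-- Apolarity of the highest weight vectors `Q·Δ^J` and `Q·D^J`. -/
theorem fischer_marked (N : Fin n → ℕ) (i : Fin n) (J : ℕ) (q : MatPoly n K) :
    fischer _ K (flagProd K N * markedMinor K i ^ J) (X (i, none) ^ J * q) =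
      J.factorial * fischer _ K (flagProd K N * flagMinor K i some ^ J) q := by
  -- The cofactor T is generalized because each differentiation turns one marked minor into an
  -- unmarked one, which is absorbed into T.
  have key : ∀ J (T : MatPoly n K), pderiv (i, none) T = 0 →
      fischer _ K (T * markedMinor K i ^ J) (X (i, none) ^ J * q) =
      J.factorial * fischer _ K (T * flagMinor K i some ^ J) q := by
    intro J
    induction J with
    | zero => intro T _; simp
    | succ J ih =>
      intro T hT
      have hder : pderiv (i, none) (T * markedMinor K i ^ (J + 1)) =
          ((J + 1 : ℕ) : K) • (T * flagMinor K i some * markedMinor K i ^ J) := by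
        rw [Derivation.leibniz, hT, Derivation.leibniz_pow, pderiv_none_markedMinor]
        simp only [smul_eq_mul, mul_zero, add_zero, Nat.add_sub_cancel, nsmul_eq_mul, smul_eq_C_mul,
          map_natCast]
        ring
      have hT' : pderiv (i, none) (T * flagMinor K i some) = 0 := by
        rw [Derivation.leibniz, hT, pderiv_none_flagMinor_some]; simp
      rw [pow_succ' (X (i, none)), mul_assoc, ← fischer_pderiv, hder, map_smul,
        LinearMap.smul_apply, ih _ hT', Nat.factorial_succ, pow_succ', mul_assoc]
      push_cast
      rw [smul_eq_mul]
      ring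
  exact key J _ (pderiv_none_flagProd i N)

end Flags

/-! ### Explicit formulas for the action on pure tensors -/

section ProjectiveAction

variable {F : Type*} [Field F] {n : ℕ}
  {V : Type*} [AddCommGroup V] [Module F V]
  [LieRingModule (Gl F n) V] [LieModule F (Gl F n) V]

theorem wittRep_tmul (D : Witt F n) (f : PolyAlg F n) (v : V) :
    wittRep F n V D (f ⊗ₜ v) =
      ∑ i, ∑ j, (pd F i (D (MvPolynomial.X j)) * f) ⊗ₜ[F] ⁅E F i j, v⁆ + D f ⊗ₜ[F] v :=
  wittOp_tmul F V D f v

theorem wittRep_xpd_tmul (a b : Fin n) (f : PolyAlg F n) (v : V) :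
    wittRep F n V (xpd F a b) (f ⊗ₜ v) = xpd F a b f ⊗ₜ v + f ⊗ₜ ⁅E F a b, v⁆ := by
  rw [wittRep_tmul, add_comm, Finset.sum_eq_single a, Finset.sum_eq_single b]
  · simp [xpd_X, pd_X]
  · intro j _ hj; simp [xpd_X, Ne.symm hj]
  · simp
  · intro i _ hi
    refine Finset.sum_eq_zero fun j _ => ?_
    rw [xpd_X]
    split_ifs <;> simp [pd_X, hi]
  · simp

theorem wittRep_pd_tmul (b : Fin n) (f : PolyAlg F n) (v : V) :
    wittRep F n V (pd F b) (f ⊗ₜ v) = pd F b f ⊗ₜ v := by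
  rw [wittRep_tmul, Finset.sum_eq_zero, zero_add]
  intro i _
  refine Finset.sum_eq_zero fun j _ => ?_
  rw [pd_X]
  split_ifs <;> simp

/-- The Jacobian entries ∂_i(x_a x_j) = δ_{ia} x_j + δ_{ij} x_a contribute a row of matrix units and
a trace term. -/
theorem wittRep_pt_tmul (a : Fin n) (f : PolyAlg F n) (v : V) :
    wittRep F n V (pt F a) (f ⊗ₜ v) = pt F a f ⊗ₜ v +
      ((MvPolynomial.X a * f) ⊗ₜ (∑ j : Fin n, ⁅E F j j, v⁆) +
        ∑ j : Fin n, (MvPolynomial.X j * f) ⊗ₜ ⁅E F a j, v⁆) := by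
  have h : ∀ i j : Fin n, pd F i (pt F a (MvPolynomial.X j)) =
      (if i = a then MvPolynomial.X j else 0) + if i = j then MvPolynomial.X a else 0 := by
    intro i j
    rw [pt_X, Derivation.leibniz, pd_X, pd_X, add_comm]
    congr 1 <;> split_ifs <;> simp
  rw [wittRep_tmul, add_comm]
  congr 1
  simp only [h, add_mul, TensorProduct.add_tmul, Finset.sum_add_distrib]
  rw [add_comm]
  congr 1
  · rw [TensorProduct.tmul_sum]
    refine Finset.sum_congr rfl fun i _ => ?_
    rw [Finset.sum_eq_single i]
    · simp
    · intro j _ hj; simp [Ne.symm hj]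
    · simp
  · rw [Finset.sum_eq_single a]
    · simp
    · intro i _ hi; simp [hi]
    · simp

theorem wittRep_comm (D D' : Witt F n) (w : PolyAlg F n ⊗[F] V) :
    wittRep F n V D (wittRep F n V D' w) =
      wittRep F n V D' (wittRep F n V D w) + wittRep F n V ⁅D, D'⁆ w := by
  rw [LieHom.map_lie, LieRing.of_associative_ring_bracket]
  simp

theorem euler_monomial (c : Fin n →₀ ℕ) (a : F) :
    euler F n (MvPolynomial.monomial c a) = (c.degree : F) • MvPolynomial.monomial c a := by
  rw [euler, sum_apply, Finsupp.degree_eq_sum, Nat.cast_sum, Finset.sum_smul]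
  refine Finset.sum_congr rfl fun r _ => ?_
  rw [xpd, Derivation.smul_apply, smul_eq_mul, pd, MvPolynomial.X_mul_pderiv_monomial,
    Nat.cast_smul_eq_nsmul]

theorem xpd_monomial_self (c : Fin n →₀ ℕ) (r : Fin n) (a : F) :
    xpd F r r (MvPolynomial.monomial c a) = (c r : F) • MvPolynomial.monomial c a := by
  rw [xpd, Derivation.smul_apply, smul_eq_mul, pd, MvPolynomial.X_mul_pderiv_monomial,
    Nat.cast_smul_eq_nsmul]

theorem X_mul_monomial (c : Fin n →₀ ℕ) (r : Fin n) :
    (MvPolynomial.X r * MvPolynomial.monomial c 1 : PolyAlg F n) =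
      MvPolynomial.monomial (c + Finsupp.single r 1) 1 := by
  rw [mul_comm, MvPolynomial.monomial_add_single, pow_one]

end ProjectiveAction

/-! ### Transporting an irreducible module into polynomials in matrix entries -/

section Functional

open MvPolynomial

variable {F : Type*} [Field F] {n : ℕ}
  {V : Type*} [AddCommGroup V] [Module F V]
  [LieRingModule (Gl F n) V] [LieModule F (Gl F n) V]

/-- The operators of `gl(n)` on `V × F[y]`, the second factor being twisted by a multiple of the
trace. -/
def pairOp (V : Type*) [AddCommGroup V] [Module F V]
    [LieRingModule (Gl F n) V] [LieModule F (Gl F n) V] (t : F) (i j : Fin n) :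
    Module.End F (V × MatPoly n F) :=
  LinearMap.prodMap (unitOp F V i j)
    (polarOp F i j + if i = j then t • LinearMap.id else 0)

theorem pairOp_fst (t : F) (i j : Fin n) (g : V × MatPoly n F) :
    (pairOp V t i j g).1 = ⁅E F i j, g.1⁆ := rfl

theorem pairOp_snd (t : F) (i j : Fin n) (g : V × MatPoly n F) :
    (pairOp V t i j g).2 = polar F i j g.2 + if i = j then t • g.2 else 0 := by
  simp only [pairOp, LinearMap.prodMap_apply, LinearMap.add_apply]
  split_ifs <;> rfl

/-- The twist is scalar, and in the commutator its two contributions appear only for j = k and l =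
i, where they cancel. -/
theorem isGlFamily_pairOp (t : F) : IsGlFamily (pairOp V t : Fin n → Fin n → _) := by
  intro i j k l g
  refine Prod.ext ?_ ?_
  · have := isGlFamily_unitOp (F := F) (V := V) i j k l g.1
    simp only [unitOp_apply] at this
    rw [Prod.fst_add, Prod.fst_sub, pairOp_fst, pairOp_fst, pairOp_fst, pairOp_fst, this]
    congr 2 <;> split_ifs <;> rfl
  · have h := polar_comm i j k l g.2
    rw [Prod.snd_add, Prod.snd_sub]
    have h1 : (if j = k then pairOp V t i l g else 0).2 =
        if j = k then (polar F i l g.2 + if l = i then t • g.2 else 0) else 0 := by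
      by_cases h : j = k
      · rw [if_pos h, if_pos h, pairOp_snd]
        simp only [eq_comm (a := i) (b := l)]
      · rw [if_neg h, if_neg h]; rfl
    have h2 : (if l = i then pairOp V t k j g else 0).2 =
        if l = i then (polar F k j g.2 + if j = k then t • g.2 else 0) else 0 := by
      by_cases h : l = i
      · rw [if_pos h, if_pos h, pairOp_snd]
        simp only [eq_comm (a := k) (b := j)]
      · rw [if_neg h, if_neg h]; rfl
    rw [h1, h2]
    simp only [pairOp_snd, map_add, h]
    split_ifs <;> simp only [Derivation.map_smul, map_zero, smul_add, smul_zero] <;> abel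

variable [CharZero F]

theorem exists_rat_functional_ne_zero {a : F} (ha : a ≠ 0) : ∃ π : F →ₗ[ℚ] ℚ, π a ≠ 0 := by
  by_contra! h
  exact ha ((Module.forall_dual_apply_eq_zero_iff ℚ a).1 h)

/-- Pairing with a rational polynomial is ℚ-linear in the coefficients of q, so it can be done
before or after applying π. -/
theorem fischer_coeffMap {σ : Type*} (π : F →ₗ[ℚ] ℚ) (p : MvPolynomial σ ℚ) (q : MvPolynomial σ F) :
    fischer σ ℚ p (coeffMap π.toAddMonoidHom q) =
      π (fischer σ F (map (algebraMap ℚ F) p) q) := by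
  induction p using MvPolynomial.induction_on' with
  | add p p' h h' => simp only [map_add, LinearMap.add_apply, h, h']
  | monomial c a =>
    rw [map_monomial, monomial_eq_smul_one, monomial_eq_smul_one c (algebraMap ℚ F a)]
    simp only [map_smul, LinearMap.smul_apply, fischer_monomial, coeff_coeffMap, smul_eq_mul,
      LinearMap.toAddMonoidHom_coe]
    have : algebraMap ℚ F a * (multiFact c * coeff c q) = (a * multiFact c) • coeff c q := by
      rw [Algebra.smul_def]
      simp [mul_assoc]
    rw [this, map_smul, smul_eq_mul, mul_assoc]

/-- The Fischer form is nondegenerate on the lowering closure of a rational vector. -/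
theorem eq_zero_of_fischer_lowerSpan (Δ : MatPoly n ℚ) {w : MatPoly n F}
    (hw : w ∈ lowerSpan (polarOp F)
      (map (algebraMap ℚ F) Δ))
    (h : ∀ u ∈ lowerSpan (polarOp F)
      (map (algebraMap ℚ F) Δ), fischer _ F u w = 0) : w = 0 := by
  set LF := lowerSpan (polarOp F)
      (map (algebraMap ℚ F) Δ)
  let LQ := lowerSpan (polarOp ℚ) Δ
  have h1 : ∀ u ∈ LQ, map (algebraMap ℚ F) u ∈ LF := by
    let S : Submodule ℚ (MatPoly n ℚ) :=
      { carrier := {u | map (algebraMap ℚ F) u ∈ LF}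
        add_mem' := fun {a b} ha hb => by
          simp only [Set.mem_ofPred_eq, map_add] at *; exact add_mem ha hb
        zero_mem' := by simp
        smul_mem' := fun c u hu => by
          simp only [Set.mem_ofPred_eq, smul_eq_C_mul, map_mul, map_C] at *
          rw [← smul_eq_C_mul]
          exact Submodule.smul_mem _ _ hu }
    have : LQ ≤ S := lowerSpan_le self_mem_lowerSpan fun a b hab u hu => by
      change map _ (polar ℚ a b u) ∈ LF
      rw [map_polar]
      exact lower_mem_lowerSpan (e := polarOp F)
        hab hu
    exact this
  have h2 : ∀ u ∈ LF, ∀ π : F →ₗ[ℚ] ℚ, coeffMap π.toAddMonoidHom u ∈ LQ := by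
    let S : Submodule F (MatPoly n F) :=
      { carrier := {u | ∀ π : F →ₗ[ℚ] ℚ, coeffMap π.toAddMonoidHom u ∈ LQ}
        add_mem' := fun {a b} ha hb π => by
          have : coeffMap π.toAddMonoidHom (a + b) =
              coeffMap π.toAddMonoidHom a + coeffMap π.toAddMonoidHom b := by
            ext c; simp [coeff_coeffMap]
          rw [this]; exact add_mem (ha π) (hb π)
        zero_mem' := fun π => by simp [coeffMap]
        smul_mem' := fun c u hu π => by
          -- The scalar c ∈ F is absorbed into the functional; this is why membership is required
          -- for all π at once.
          have : coeffMap π.toAddMonoidHom (c • u) =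
              coeffMap (π.comp (LinearMap.mulLeft ℚ c)).toAddMonoidHom u := by
            ext d; simp [coeff_coeffMap]
          rw [this]; exact hu _ }
    have : LF ≤ S := by
      refine lowerSpan_le (fun π => ?_) fun a b hab u hu π => ?_
      · have : coeffMap π.toAddMonoidHom (map (algebraMap ℚ F) Δ) = π 1 • Δ := by
          ext d
          simp only [coeff_coeffMap, coeff_map, coeff_smul, LinearMap.toAddMonoidHom_coe,
            Algebra.algebraMap_eq_smul_one, map_smul, smul_eq_mul]
          ring
        rw [this]
        exact Submodule.smul_mem _ _ self_mem_lowerSpan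
      · change coeffMap π.toAddMonoidHom (polar F a b u) ∈ LQ
        rw [coeffMap_polar]
        exact lower_mem_lowerSpan (e := polarOp ℚ)
          hab (hu π)
    exact this
  -- Each rational projection of w lies in `LQ`, hence in `LF` after extension of scalars, so it is
  -- orthogonal to w and therefore to itself.
  have h3 : ∀ π : F →ₗ[ℚ] ℚ, coeffMap π.toAddMonoidHom w = 0 := fun π => by
    apply eq_zero_of_fischer_self
    rw [fischer_coeffMap, h _ (h1 _ (h2 w hw π)), map_zero]
  ext c
  by_contra hc
  obtain ⟨π, hπ⟩ := exists_rat_functional_ne_zero hc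
  apply hπ
  have := congrArg (coeff c) (h3 π)
  simpa [coeff_coeffMap] using this

/-- An irreducible module embeds, compatibly with the lowering operators, into the polynomials in
matrix entries, the highest weight vector going to a product of leading minors. -/
theorem exists_lowering_map [LieModule.IsIrreducible F (Gl F n) V] {μ : Fin n → F} {v : V}
    (hv : IsHighestVec μ v) (N : Fin n → ℕ) {w : Fin n → ℕ} {t : F}
    (hw : IsPolarHighest w (flagProd F N)) (hμ : ∀ i, μ i = w i + t) :
    ∃ ι : V →ₗ[F] MatPoly n F, ι v = flagProd F N ∧
      ∀ a b : Fin n, b < a → ∀ y, ι ⁅E F a b, y⁆ = polar F a b (ι y) := by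
  set Δ := flagProd F N with hΔ
  let e : Fin n → Fin n → Module.End F (V × MatPoly n F) := pairOp V t
  let G := lowerSpan e (v, Δ)
  have hst : ∀ p q, ∀ g ∈ G, e p q g ∈ G := fun p q g hg => by
    refine lowerSpan_stable (isGlFamily_pairOp t) (fun i j hij => ?_) (fun i => ⟨μ i, ?_⟩) p q hg
    · refine Prod.ext ?_ ?_
      · rw [pairOp_fst, hv.raise i j hij]; rfl
      · rw [pairOp_snd, if_neg hij.ne, hw.raise i j hij]; simp
    · refine Prod.ext ?_ ?_
      · rw [pairOp_fst, hv.diag]; rfl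
      · rw [pairOp_snd, if_pos rfl, hw.diag, ← add_smul, ← hμ]; rfl
  obtain ⟨ξ, hξ1, hξ⟩ := exists_highest_functional hv
  -- Both sides vanish after lowering and agree on the generator (v, Δ).
  have hG1 : ∀ g ∈ G, fischer _ F Δ g.2 = ξ g.1 * fischer _ F Δ Δ := by
    let S : Submodule F (V × MatPoly n F) := LinearMap.ker
      ((fischer _ F Δ).comp (LinearMap.snd F V (MatPoly n F)) -
        (fischer _ F Δ Δ) • ξ.comp (LinearMap.fst F V (MatPoly n F)))
    have hS : ∀ g, g ∈ S ↔ fischer _ F Δ g.2 = ξ g.1 * fischer _ F Δ Δ := fun g => by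
      simp [S, LinearMap.mem_ker, sub_eq_zero, mul_comm]
    have : G ≤ S := by
      refine lowerSpan_le ((hS _).2 (by simp [hξ1])) fun a b hab g _ => (hS _).2 ?_
      rw [pairOp_fst, hξ a b hab, zero_mul, pairOp_snd, if_neg hab.ne', add_zero, ← fischer_polar,
        hw.raise b a hab]
      simp
    exact fun g hg => (hS g).1 (this hg)
  have hG2 : ∀ g ∈ G, g.2 ∈ lowerSpan (polarOp F)
      Δ := by
    have : G ≤ (lowerSpan (polarOp F)
        Δ).comap (LinearMap.snd F V (MatPoly n F)) := by
      refine lowerSpan_le self_mem_lowerSpan fun a b hab g hg => ?_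
      rw [Submodule.mem_comap, LinearMap.snd_apply, pairOp_snd, if_neg hab.ne', add_zero]
      exact lower_mem_lowerSpan (e := polarOp F)
        hab hg
    exact this
  -- This makes G the graph of a map. The second components over 0 are stable under raising and
  -- orthogonal to Δ, so by contravariance they are orthogonal to the whole lowering closure of Δ,
  -- to which they belong.
  have hG3 : ∀ w, ((0, w) : V × MatPoly n F) ∈ G → w = 0 := by
    intro w hw0
    have hΔQ : Δ = map (algebraMap ℚ F) (flagProd ℚ N) := (map_flagProd _ N).symm
    have hall : ∀ u ∈ lowerSpan (polarOp F) Δ,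
        ∀ w, ((0, w) : V × MatPoly n F) ∈ G → fischer _ F u w = 0 := by
      let S : Submodule F (MatPoly n F) :=
        { carrier := {u | ∀ w, ((0, w) : V × MatPoly n F) ∈ G → fischer _ F u w = 0}
          add_mem' := fun {a b} ha hb w hw => by
            rw [map_add, LinearMap.add_apply, ha w hw, hb w hw, add_zero]
          zero_mem' := fun w _ => by simp
          smul_mem' := fun c u hu w hw => by
            rw [map_smul, LinearMap.smul_apply, hu w hw, smul_zero] }
      have : lowerSpan (polarOp F) Δ ≤ S := by
        refine lowerSpan_le (fun w hw => ?_) fun a b hab u hu w hw => ?_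
        · rw [hG1 _ hw]; simp
        · have h0 := hst b a _ hw
          have : e b a ((0, w) : V × MatPoly n F) = (0, polar F b a w) := by
            refine Prod.ext ?_ ?_
            · rw [pairOp_fst]; simp
            · rw [pairOp_snd, if_neg hab.ne, add_zero]
          rw [this] at h0
          have h1 := hu _ h0
          rw [← fischer_polar] at h1
          exact h1
      exact this
    have hmem := hG2 _ hw0
    rw [hΔQ] at hall hmem
    exact eq_zero_of_fischer_lowerSpan _ hmem fun u hu => hall u hu w hw0
  let φ : G →ₗ[F] V := (LinearMap.fst F V (MatPoly n F)).comp G.subtype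
  have hφ : Function.Bijective φ := by
    constructor
    · rw [← LinearMap.ker_eq_bot, LinearMap.ker_eq_bot']
      rintro ⟨⟨a, b⟩, hg⟩ h
      have ha : a = 0 := h
      subst ha
      have := hG3 b hg
      subst this
      rfl
    · intro y
      have : y ∈ G.map (LinearMap.fst F V (MatPoly n F)) := by
        refine highest_induction hv (G.map (LinearMap.fst F V (MatPoly n F)))
          ⟨(v, Δ), self_mem_lowerSpan, rfl⟩ (fun a b hab y hy => ?_) y
        obtain ⟨g, hg, rfl⟩ := hy
        exact ⟨e a b g, hst a b g hg, rfl⟩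
      obtain ⟨g, hg, rfl⟩ := this
      exact ⟨⟨g, hg⟩, rfl⟩
  let Φ := LinearEquiv.ofBijective φ hφ
  have hΦ : ∀ g (hg : g ∈ G), Φ.symm g.1 = ⟨g, hg⟩ := fun g hg => by
    rw [LinearEquiv.symm_apply_eq]; rfl
  have hΦ1 : ∀ y, ((Φ.symm y : V × MatPoly n F)).1 = y := fun y => Φ.apply_symm_apply y
  refine ⟨(LinearMap.snd F V (MatPoly n F)).comp (G.subtype.comp Φ.symm.toLinearMap), ?_, ?_⟩
  · have := hΦ (v, Δ) self_mem_lowerSpan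
    simp only [LinearMap.comp_apply, LinearEquiv.coe_coe]
    rw [this]
    rfl
  · intro a b hab y
    have h1 := hΦ _ (hst a b _ (Φ.symm y).2)
    rw [pairOp_fst, hΦ1] at h1
    simp only [LinearMap.comp_apply, LinearEquiv.coe_coe]
    rw [h1]
    simp only [Submodule.subtype_apply, LinearMap.snd_apply]
    rw [pairOp_snd, if_neg hab.ne', add_zero]

end Functional

/-! ### The functional detecting x_i^J ⊗ v -/

section DetectingFunctional

open MvPolynomial

variable {F : Type*} [Field F] {n : ℕ}
  {V : Type*} [AddCommGroup V] [Module F V]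
  [LieRingModule (Gl F n) V] [LieModule F (Gl F n) V]

/-- Placing 𝒜 in the additional column is equivariant for gl(n). -/
theorem polar_rename (a b : Fin n) (f : PolyAlg F n) :
    polar F a b (rename (fun l => (l, none)) f) = rename (fun l => (l, none)) (xpd F a b f) := by
  induction f using MvPolynomial.induction_on with
  | C c => rw [rename_C, derivation_C, derivation_C, map_zero]
  | add p q hp hq => simp only [map_add, hp, hq]
  | mul_X p i hp =>
    rw [map_mul, Derivation.leibniz, hp, rename_X, polar_X, Derivation.leibniz, xpd_X]
    simp only [smul_eq_mul, map_add, map_mul, rename_X]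
    split_ifs <;> simp

theorem sum_range_tail_sub (D : ℕ → ℕ) (hD : Antitone D) (l m : ℕ) (h : l ≤ m) :
    ∑ r ∈ Finset.range m, (if l < r + 1 then D r - D (r + 1) else 0) = D l - D m := by
  induction m, h using Nat.le_induction with
  | base =>
    rw [Nat.sub_self]
    exact Finset.sum_eq_zero fun r hr => if_neg (by simpa using hr)
  | succ m hm ih =>
    rw [Finset.sum_range_succ, ih, if_pos (Nat.lt_succ_of_le hm)]
    have := hD hm
    have := hD (show m ≤ m + 1 by omega)
    omega

theorem fischer_map {K σ : Type*} [Field K] (φ : K →+* F) (p q : MvPolynomial σ K) :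
    fischer σ F (map φ p) (map φ q) = φ (fischer σ K p q) := by
  induction p using MvPolynomial.induction_on' with
  | add p p' h h' => simp only [map_add, LinearMap.add_apply, h, h']
  | monomial c a =>
    rw [map_monomial, monomial_eq_smul_one, monomial_eq_smul_one c a]
    simp only [map_smul, LinearMap.smul_apply, fischer_monomial, coeff_map, smul_eq_mul, map_mul,
      map_natCast]

variable [CharZero F]

/-- The highest weight is, up to a multiple of the trace, that of a product of leading minors. -/
theorem exists_flag_exponents [Module.Finite F V] [NeZero n] {μ : Fin n → F} {v : V}
    (hv : IsHighestVec μ v) :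
    ∃ (N w : Fin n → ℕ) (t : F), IsPolarHighest w (flagProd F N) ∧ (∀ l, μ l = w l + t) ∧
      ∀ r s : Fin n, (r : ℕ) + 1 = s → (N r : F) = μ r - μ s := by
  have hn : 0 < n := Nat.pos_of_ne_zero (NeZero.ne n)
  let L : Fin n := ⟨n - 1, by omega⟩
  have hex : ∀ i : Fin n, ∃ m : ℕ, μ i - μ L = m := by
    intro i
    rcases lt_or_eq_of_le (show (i : ℕ) ≤ n - 1 by omega) with h | h
    · exact exists_nat_sub hv (show i < L from h)
    · have : i = L := Fin.ext h
      exact ⟨0, by rw [this]; simp⟩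
  choose d hd using hex
  -- Extension by zero makes D n = 0, the endpoint of the telescoping sum that recovers d from the
  -- exponents.
  let D : ℕ → ℕ := fun r => if h : r < n then d ⟨r, h⟩ else 0
  have hDval : ∀ i : Fin n, D i = d i := fun i => by simp [D]
  have hDanti : Antitone D := by
    refine antitone_nat_of_succ_le fun r => ?_
    by_cases h : r + 1 < n
    · have h' : r < n := by omega
      simp only [D, h, h', dif_pos]
      obtain ⟨m, hm⟩ := exists_nat_sub hv
        (show (⟨r, h'⟩ : Fin n) < ⟨r + 1, h⟩ from Nat.lt_succ_self r)
      have h1 := hd ⟨r, h'⟩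
      have h2 := hd ⟨r + 1, h⟩
      have : d ⟨r, h'⟩ = d ⟨r + 1, h⟩ + m := by
        have : ((d ⟨r, h'⟩ : ℕ) : F) = (d ⟨r + 1, h⟩ + m : ℕ) := by
          push_cast
          rw [← h1, ← h2, ← hm]; ring
        exact_mod_cast this
      omega
    · simp [D, h]
  refine ⟨fun r => D r - D (r + 1), d, μ L, ?_, fun l => by rw [← hd l]; ring, ?_⟩
  · have h := isPolarHighest_flagProd (K := F) (n := n) (fun r => D r - D (r + 1))
    have h2 : (∑ r : Fin n, (D r - D (r + 1)) • fun c : Fin n => if (c : ℕ) < r + 1 then 1 else 0) =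
        d := by
      funext l
      have h3 := sum_range_tail_sub D hDanti l n l.2.le
      rw [← Fin.sum_univ_eq_sum_range (fun r => if (l : ℕ) < r + 1 then D r - D (r + 1) else 0)]
        at h3
      have h4 : D n = 0 := by simp [D]
      rw [h4, Nat.sub_zero, hDval] at h3
      rw [Finset.sum_apply, ← h3]
      refine Finset.sum_congr rfl fun r _ => ?_
      simp
    rwa [h2] at h
  · intro r s hrs
    have h1 : D (r + 1) ≤ D r := hDanti (Nat.le_succ _)
    rw [Nat.cast_sub h1, hrs, hDval, hDval, ← hd, ← hd]
    ring

/-- A functional on `𝒜 ⊗ V` that vanishes on the image of the lowering operators and detects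
`x_i^J ⊗ v`; it exists if `μ + J ε_i` is dominant. -/
theorem exists_lowest_functional [LieModule.IsIrreducible F (Gl F n) V] [Module.Finite F V]
    [NeZero n] {μ : Fin n → F} {v : V} (hv : IsHighestVec μ v) (i : Fin n) (J : ℕ)
    (hJ : ∀ r : Fin n, (r : ℕ) + 1 = i → ∃ m : ℕ, μ r - μ i = J + m) :
    ∃ lam : PolyAlg F n ⊗[F] V →ₗ[F] F,
      (∀ a b, b < a → ∀ w, lam (wittRep F n V (xpd F a b) w) = 0) ∧
      lam (monomial (Finsupp.single i J) 1 ⊗ₜ v) ≠ 0 ∧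
      ∀ c, c ≠ Finsupp.single i J → lam (monomial c 1 ⊗ₜ v) = 0 := by
  obtain ⟨N, w, t, hw, hμ, hN⟩ := exists_flag_exponents hv
  obtain ⟨ι, hι, hιlow⟩ := exists_lowering_map hv N hw hμ
  have hNJ : ∀ r : Fin n, (r : ℕ) + 1 = i → J ≤ N r := by
    intro r hr
    obtain ⟨m, hm⟩ := hJ r hr
    rw [← hN r i hr] at hm
    have : N r = J + m := by exact_mod_cast hm
    omega
  obtain ⟨N', hN'⟩ := exists_flagProd_eq (K := F) N i J hNJ
  set h : MatPoly n F := flagProd F N' * markedMinor F i ^ J with hh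
  have hhw := (isPolarHighest_flagProd (K := F) N').mul
    ((isPolarHighest_flagMinor (K := F) (i + 1) (Function.update some i none)).pow J)
  have hΔw := (isPolarHighest_flagProd (K := F) N').mul
    ((isPolarHighest_flagMinor (K := F) (i : ℕ) (some : Fin n → Option (Fin n))).pow J)
  rw [← hN'] at hΔw
  set q := (∑ r : Fin n, N' r • fun c : Fin n => if (c : ℕ) < r + 1 then 1 else 0)
  -- The exponents N' are not explicit; comparing two weights of the same nonzero polynomial relates
  -- them to w.
  have hwq : ∀ c, w c = q c + (J • fun c : Fin n => if (c : ℕ) < i then 1 else 0) c := by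
    intro c
    have h1 := (hw.diag c).symm.trans (hΔw.diag c)
    have h2 := smul_left_injective F (flagProd_ne_zero (K := F) N) h1
    exact_mod_cast h2
  have hraise : ∀ a b, b < a → polar F b a h = 0 := fun a b hab => hhw.raise b a hab
  let ren : PolyAlg F n →ₐ[F] MatPoly n F := rename (fun l => (l, none))
  -- Pairing with h kills images of lowering because h is killed by raising, and it sees only the
  -- weight of h, which is w + J ε_i.
  let lam : PolyAlg F n ⊗[F] V →ₗ[F] F := (fischer _ F h).comp
    (TensorProduct.lift (((LinearMap.mul F (MatPoly n F)).compl₂ ι).comp ren.toLinearMap))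
  have hlam : ∀ f y, lam (f ⊗ₜ y) = fischer _ F h (ren f * ι y) := fun f y => rfl
  refine ⟨lam, fun a b hab z => ?_, ?_, fun c hc => ?_⟩
  · induction z using TensorProduct.induction_on with
    | zero => simp
    | add x y hx hy => rw [map_add, map_add, hx, hy, add_zero]
    | tmul f y =>
      rw [wittRep_xpd_tmul, map_add, hlam, hlam, hιlow a b hab, ← map_add]
      have : ren (xpd F a b f) * ι y + ren f * polar F a b (ι y) = polar F a b (ren f * ι y) := by
        rw [Derivation.leibniz, ← polar_rename, smul_eq_mul, smul_eq_mul, mul_comm (ι y), add_comm]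
      rw [this, ← fischer_polar, hraise a b hab]
      simp
  · have h1 : ren (monomial (Finsupp.single i J) 1) = X (i, none) ^ J := by
      rw [← X_pow_eq_monomial, map_pow]
      simp [ren]
    rw [hlam, h1, hι, hh, fischer_marked, ← hN']
    refine mul_ne_zero (Nat.cast_ne_zero.2 (Nat.factorial_ne_zero _)) ?_
    rw [← map_flagProd (algebraMap ℚ F) N]
    intro h0
    rw [fischer_map, map_eq_zero] at h0
    exact flagProd_ne_zero N (eq_zero_of_fischer_self h0)
  · by_contra hne
    apply hc
    ext l
    have h1 : polar F l l (ren (monomial c 1) * ι v) =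
        ((w l + c l : ℕ) : F) • (ren (monomial c 1) * ι v) := by
      rw [Derivation.leibniz, polar_rename, xpd_monomial_self, hι, hw.diag, map_smul]
      simp only [smul_eq_mul, mul_smul_comm, Nat.cast_add, add_smul]
      rw [mul_comm (flagProd F N)]
    -- Diagonal polarizations are self-adjoint, so a nonzero pairing forces equal weights, which
    -- determines c.
    have h2 := fischer_polar l l h (ren (monomial c 1) * ι v)
    rw [h1, show polar F l l h = _ from hhw.diag l, map_smul, map_smul,
      LinearMap.smul_apply, smul_eq_mul, smul_eq_mul] at h2
    have h3 := mul_right_cancel₀ hne h2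
    have h4 : (q + J • (fun c => if (c : ℕ) < i + 1 then 1 else 0 : Fin n → ℕ)) l = w l + c l := by
      exact_mod_cast h3
    rw [hwq] at h4
    simp only [Pi.add_apply, Pi.smul_apply, smul_eq_mul] at h4
    rcases lt_trichotomy l i with hl | hl | hl
    · have hl' : (l : ℕ) < i := hl
      rw [if_pos (Nat.lt_succ_of_lt hl'), if_pos hl'] at h4
      rw [Finsupp.single_eq_of_ne hl.ne]
      omega
    · subst hl
      rw [if_pos (Nat.lt_succ_self _), if_neg (lt_irrefl _)] at h4
      rw [Finsupp.single_eq_same]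
      omega
    · have hl' : (i : ℕ) < l := hl
      rw [if_neg (by omega), if_neg (by omega)] at h4
      rw [Finsupp.single_eq_of_ne hl.ne']
      omega

end DetectingFunctional

/-! ### Homogeneous pieces and how the generators of L_{n+1} act on them -/

section DegreePieces

open MvPolynomial

variable {F : Type*} [Field F] {n : ℕ}
  {V : Type*} [AddCommGroup V] [Module F V]

theorem monomial_tmul_mem_degAV {k : ℕ} {c : Fin n →₀ ℕ} (hc : c.degree = k) (y : V) :
    (monomial c 1 : PolyAlg F n) ⊗ₜ[F] y ∈ degAV F n V k :=
  Submodule.subset_span ⟨c, y, hc, rfl⟩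

theorem degAV_le {k : ℕ} {S : Submodule F (PolyAlg F n ⊗[F] V)}
    (h : ∀ (c : Fin n →₀ ℕ) (y : V), c.degree = k → (monomial c 1 : PolyAlg F n) ⊗ₜ[F] y ∈ S) :
    degAV F n V k ≤ S :=
  Submodule.span_le.2 (by rintro _ ⟨c, y, hc, rfl⟩; exact h c y hc)

variable [LieRingModule (Gl F n) V] [LieModule F (Gl F n) V]

theorem degree_add_single (c : Fin n →₀ ℕ) (r : Fin n) :
    (c + Finsupp.single r 1).degree = c.degree + 1 := by
  rw [map_add, Finsupp.degree_single]

theorem xpd_monomial (a b : Fin n) (c : Fin n →₀ ℕ) :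
    ∃ d : Fin n →₀ ℕ, ∃ m : F, d.degree = c.degree ∧
      xpd F a b (monomial c 1) = m • monomial d 1 := by
  by_cases h : c b = 0
  · refine ⟨c, 0, rfl, ?_⟩
    rw [xpd, Derivation.smul_apply, pd, pderiv_monomial, h]
    simp
  · have hc : c = c - Finsupp.single b 1 + Finsupp.single b 1 := by
      ext l
      by_cases hl : l = b
      · subst hl; simp; omega
      · simp [Finsupp.single_eq_of_ne hl]
    refine ⟨c - Finsupp.single b 1 + Finsupp.single a 1, c b, ?_, ?_⟩
    · conv_rhs => rw [hc]
      rw [degree_add_single, degree_add_single]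
    · rw [xpd, Derivation.smul_apply, pd, pderiv_monomial, ← X_mul_monomial, one_mul,
        monomial_eq_smul_one, smul_eq_mul, mul_smul_comm]

theorem wittRep_pt_mem_degAV (a : Fin n) {k : ℕ} {w : PolyAlg F n ⊗[F] V}
    (hw : w ∈ degAV F n V k) : wittRep F n V (pt F a) w ∈ degAV F n V (k + 1) := by
  have : degAV F n V k ≤ (degAV F n V (k + 1)).comap (wittRep F n V (pt F a)) := by
    refine degAV_le fun c y hc => ?_
    have hX : ∀ r (z : V), (X r * monomial c 1 : PolyAlg F n) ⊗ₜ[F] z ∈ degAV F n V (k + 1) :=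
      fun r z => by
        rw [X_mul_monomial]
        exact monomial_tmul_mem_degAV (by rw [degree_add_single, hc]) z
    rw [Submodule.mem_comap, wittRep_pt_tmul]
    refine add_mem ?_ (add_mem (hX a _) (sum_mem fun j _ => hX j _))
    rw [pt, Derivation.smul_apply, euler_monomial, smul_eq_mul, mul_smul_comm,
      ← TensorProduct.smul_tmul']
    exact Submodule.smul_mem _ _ (hX a y)
  exact this hw

theorem wittRep_pd_mem_degAV (b : Fin n) {k : ℕ} {w : PolyAlg F n ⊗[F] V}
    (hw : w ∈ degAV F n V (k + 1)) : wittRep F n V (pd F b) w ∈ degAV F n V k := by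
  have : degAV F n V (k + 1) ≤ (degAV F n V k).comap (wittRep F n V (pd F b)) := by
    refine degAV_le fun c y hc => ?_
    rw [Submodule.mem_comap, wittRep_pd_tmul, pd, pderiv_monomial]
    by_cases h : c b = 0
    · rw [h]; simp
    · rw [one_mul, monomial_eq_smul_one, ← TensorProduct.smul_tmul']
      refine Submodule.smul_mem _ _ (monomial_tmul_mem_degAV ?_ y)
      have h2 : c = c - Finsupp.single b 1 + Finsupp.single b 1 := by
        ext l
        by_cases hl : l = b
        · subst hl; simp; omega
        · simp [Finsupp.single_eq_of_ne hl]
      rw [h2, degree_add_single] at hc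
      omega
  exact this hw

theorem wittRep_pt_comm (a b : Fin n) :
    Commute (wittRep F n V (pt F a)) (wittRep F n V (pt F b)) := by
  refine LinearMap.ext fun w => ?_
  have := wittRep_comm (V := V) (pt F a) (pt F b) w
  rw [lie_pt_pt, map_zero, LinearMap.zero_apply, add_zero] at this
  exact this

/-- The p_i commute, so an arbitrary word can be sorted into a monotone one. -/
theorem word_mem_degUP {k : ℕ} (i : Fin k → Fin n) (y : V) :
    (List.ofFn fun s => wittRep F n V (pt F (i s))).prod (1 ⊗ₜ[F] y) ∈ degUP F n V k := by
  refine Submodule.subset_span ⟨i ∘ Tuple.sort i, y, Tuple.monotone_sort i, ?_⟩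
  have h : List.Perm (List.ofFn fun s => wittRep F n V (pt F (i s)))
      (List.ofFn fun s => wittRep F n V (pt F ((i ∘ Tuple.sort i) s))) :=
    (Equiv.Perm.ofFn_comp_perm (Tuple.sort i) (fun s => wittRep F n V (pt F (i s)))).symm
  rw [h.prod_eq']
  rw [List.pairwise_ofFn]
  exact fun a b _ => wittRep_pt_comm _ _

theorem one_tmul_mem_degUP (y : V) : (1 : PolyAlg F n) ⊗ₜ[F] y ∈ degUP F n V 0 := by
  simpa using word_mem_degUP (F := F) (n := n) Fin.elim0 y

theorem degUP_zero_le {S : Submodule F (PolyAlg F n ⊗[F] V)}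
    (h : ∀ y : V, (1 : PolyAlg F n) ⊗ₜ[F] y ∈ S) : degUP F n V 0 ≤ S := by
  refine Submodule.span_le.2 ?_
  rintro _ ⟨i, y, _, rfl⟩
  simpa using h y

theorem wittRep_pt_mem_degUP (a : Fin n) {k : ℕ} {w : PolyAlg F n ⊗[F] V}
    (hw : w ∈ degUP F n V k) : wittRep F n V (pt F a) w ∈ degUP F n V (k + 1) := by
  have : degUP F n V k ≤ (degUP F n V (k + 1)).comap (wittRep F n V (pt F a)) := by
    refine Submodule.span_le.2 ?_
    rintro _ ⟨i, y, _, rfl⟩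
    have := word_mem_degUP (F := F) (Fin.cons a i : Fin (k + 1) → Fin n) y
    rw [List.ofFn_succ, List.prod_cons] at this
    simpa using this
  exact this hw

theorem degUP_succ_le {k : ℕ} {S : Submodule F (PolyAlg F n ⊗[F] V)}
    (h : ∀ a, ∀ w ∈ degUP F n V k, wittRep F n V (pt F a) w ∈ S) : degUP F n V (k + 1) ≤ S := by
  refine Submodule.span_le.2 ?_
  rintro _ ⟨i, y, _, rfl⟩
  rw [List.ofFn_succ, List.prod_cons]
  exact h _ _ (word_mem_degUP _ y)

theorem degUP_le_degAV (k : ℕ) : degUP F n V k ≤ degAV F n V k := by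
  induction k with
  | zero =>
    refine degUP_zero_le fun y => ?_
    have := monomial_tmul_mem_degAV (F := F) (c := (0 : Fin n →₀ ℕ)) (k := 0) (by simp) y
    simpa using this
  | succ k ih => exact degUP_succ_le fun a w hw => wittRep_pt_mem_degAV a (ih hw)

theorem wittRep_xpd_pt (a b i : Fin n) (w : PolyAlg F n ⊗[F] V) :
    wittRep F n V (xpd F a b) (wittRep F n V (pt F i) w) =
      wittRep F n V (pt F i) (wittRep F n V (xpd F a b) w) +
        if b = i then wittRep F n V (pt F a) w else 0 := by
  rw [wittRep_comm, lie_xpd_pt]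
  congr 1
  split_ifs
  · rfl
  · rw [map_zero]; rfl

theorem wittRep_pd_pt (b i : Fin n) (w : PolyAlg F n ⊗[F] V) :
    wittRep F n V (pd F b) (wittRep F n V (pt F i) w) =
      wittRep F n V (pt F i) (wittRep F n V (pd F b) w) +
        (wittRep F n V (xpd F i b) w + if b = i then wittRep F n V (euler F n) w else 0) := by
  rw [wittRep_comm, lie_pd_pt, map_add, LinearMap.add_apply]
  congr 2
  split_ifs
  · rfl
  · rw [map_zero]; rfl

theorem wittRep_euler (w : PolyAlg F n ⊗[F] V) :
    wittRep F n V (euler F n) w = ∑ r, wittRep F n V (xpd F r r) w := by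
  have h : wittRep F n V (euler F n) = ∑ r, wittRep F n V (xpd F r r) := by
    rw [euler]
    exact map_sum (wittRep F n V : Witt F n →ₗ[F] Module.End F (PolyAlg F n ⊗[F] V)) _ _
  rw [h, LinearMap.sum_apply]

/-- The bracket of x_a ∂_b with p_i is again in P, and 1 ⊗ V is stable. -/
theorem wittRep_xpd_mem_degUP (a b : Fin n) {k : ℕ} {w : PolyAlg F n ⊗[F] V}
    (hw : w ∈ degUP F n V k) : wittRep F n V (xpd F a b) w ∈ degUP F n V k := by
  have : degUP F n V k ≤ (degUP F n V k).comap (wittRep F n V (xpd F a b)) := by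
    clear hw w
    induction k with
    | zero =>
      refine degUP_zero_le fun y => ?_
      rw [Submodule.mem_comap, wittRep_xpd_tmul, Derivation.map_one_eq_zero,
        TensorProduct.zero_tmul,
        zero_add]
      exact one_tmul_mem_degUP _
    | succ k ih =>
      refine degUP_succ_le fun i w hw => ?_
      rw [Submodule.mem_comap, wittRep_xpd_pt]
      refine add_mem (wittRep_pt_mem_degUP i (ih hw)) ?_
      split_ifs
      · exact wittRep_pt_mem_degUP a hw
      · exact zero_mem _
  exact this hw

theorem wittRep_euler_mem_degUP {k : ℕ} {w : PolyAlg F n ⊗[F] V}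
    (hw : w ∈ degUP F n V k) : wittRep F n V (euler F n) w ∈ degUP F n V k := by
  rw [wittRep_euler]
  exact sum_mem fun r _ => wittRep_xpd_mem_degUP r r hw

theorem wittRep_pd_degUP_zero (b : Fin n) {w : PolyAlg F n ⊗[F] V}
    (hw : w ∈ degUP F n V 0) : wittRep F n V (pd F b) w = 0 := by
  have : degUP F n V 0 ≤ LinearMap.ker (wittRep F n V (pd F b)) := by
    refine degUP_zero_le fun y => ?_
    rw [LinearMap.mem_ker, wittRep_pd_tmul, Derivation.map_one_eq_zero, TensorProduct.zero_tmul]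
  exact this hw

/-- Brackets of ∂_b with p_i have degree zero, and degree zero operators preserve the shorter words.
-/
theorem wittRep_pd_mem_degUP (b : Fin n) {k : ℕ} {w : PolyAlg F n ⊗[F] V}
    (hw : w ∈ degUP F n V (k + 1)) : wittRep F n V (pd F b) w ∈ degUP F n V k := by
  have : degUP F n V (k + 1) ≤ (degUP F n V k).comap (wittRep F n V (pd F b)) := by
    clear hw w
    induction k with
    | zero =>
      refine degUP_succ_le fun i w hw => ?_
      rw [Submodule.mem_comap, wittRep_pd_pt, wittRep_pd_degUP_zero b hw, map_zero, zero_add]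
      refine add_mem (wittRep_xpd_mem_degUP i b hw) ?_
      split_ifs
      · exact wittRep_euler_mem_degUP hw
      · exact zero_mem _
    | succ k ih =>
      refine degUP_succ_le fun i w hw => ?_
      rw [Submodule.mem_comap, wittRep_pd_pt]
      refine add_mem (wittRep_pt_mem_degUP i (ih hw)) (add_mem (wittRep_xpd_mem_degUP i b hw) ?_)
      split_ifs
      · exact wittRep_euler_mem_degUP hw
      · exact zero_mem _
  exact this hw

end DegreePieces

/-! ### Where the homogeneous pieces agree and where they differ -/

section Comparison

open MvPolynomial

variable {F : Type*} [Field F] {n : ℕ}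
  {V : Type*} [AddCommGroup V] [Module F V]
  [LieRingModule (Gl F n) V] [LieModule F (Gl F n) V] [LieModule.IsIrreducible F (Gl F n) V]
  {μ : Fin n → F} {v : V}

/-- The action of `p_i` on `x^c ⊗ v`, up to images of lowering operators. -/
theorem wittRep_pt_highest (hv : IsHighestVec μ v) (i : Fin n) (c : Fin n →₀ ℕ) :
    wittRep F n V (pt F i) (monomial c 1 ⊗ₜ v) =
      (c.degree + ∑ j, μ j + μ i - ∑ l ∈ Finset.Iio i, ((c l : F) + 1)) •
        ((monomial (c + Finsupp.single i 1) 1 : PolyAlg F n) ⊗ₜ[F] v) +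
      ∑ l ∈ Finset.Iio i, wittRep F n V (xpd F i l)
        ((monomial (c + Finsupp.single l 1) 1 : PolyAlg F n) ⊗ₜ[F] v) := by
  -- This trades the terms with E_{i,l} v, l < i, for images of x_i ∂_l, at the cost of c_l + 1 in
  -- the coefficient.
  have hx : ∀ l ∈ Finset.Iio i, wittRep F n V (xpd F i l)
        ((monomial (c + Finsupp.single l 1) 1 : PolyAlg F n) ⊗ₜ[F] v) =
      ((c l : F) + 1) • ((monomial (c + Finsupp.single i 1) 1 : PolyAlg F n) ⊗ₜ[F] v) +
        (monomial (c + Finsupp.single l 1) 1 : PolyAlg F n) ⊗ₜ[F] ⁅E F i l, v⁆ := by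
    intro l _
    rw [wittRep_xpd_tmul]
    congr 1
    rw [xpd, Derivation.smul_apply, pd, pderiv_monomial, add_tsub_cancel_right, one_mul,
      monomial_eq_smul_one, smul_eq_mul, mul_smul_comm, X_mul_monomial, TensorProduct.smul_tmul']
    simp
  have hsum : ∑ l : Fin n, (monomial (c + Finsupp.single l 1) 1 : PolyAlg F n) ⊗ₜ[F] ⁅E F i l, v⁆ =
      ∑ l ∈ Finset.Iio i, (monomial (c + Finsupp.single l 1) 1 : PolyAlg F n) ⊗ₜ[F] ⁅E F i l, v⁆ +
        μ i • ((monomial (c + Finsupp.single i 1) 1 : PolyAlg F n) ⊗ₜ[F] v) := by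
    rw [← TensorProduct.tmul_smul, ← hv.diag i, add_comm]
    refine (Finset.sum_subset (Finset.subset_univ (insert i (Finset.Iio i)))
      fun l _ hl => ?_).symm.trans
      (Finset.sum_insert (by simp))
    have h : i < l := by
      rw [Finset.mem_insert, Finset.mem_Iio, not_or, not_lt] at hl
      exact lt_of_le_of_ne hl.2 (Ne.symm hl.1)
    rw [hv.raise i l h, TensorProduct.tmul_zero]
  rw [wittRep_pt_tmul, sum_diag_lie hv, pt, Derivation.smul_apply, euler_monomial, smul_eq_mul,
    mul_smul_comm, ← TensorProduct.smul_tmul', TensorProduct.tmul_smul]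
  simp only [X_mul_monomial]
  rw [hsum, Finset.sum_congr rfl hx, Finset.sum_add_distrib (f := fun l => ((c l : F) + 1) • _),
    ← Finset.sum_smul]
  module

theorem sum_Iio_add_of_support (c : Fin n →₀ ℕ) (i : Fin n) (h : ∀ l, i < l → c l = 0) :
    ∑ l ∈ Finset.Iio i, c l + c i = c.degree := by
  rw [Finsupp.degree_eq_sum, add_comm, ← Finset.sum_insert (by simp)]
  refine Finset.sum_subset (Finset.subset_univ _) fun l _ hl => h l ?_
  rw [Finset.mem_insert, Finset.mem_Iio, not_or, not_lt] at hl
  exact lt_of_le_of_ne hl.2 (Ne.symm hl.1)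

/-- Strip off the last variable of x^c and apply p_i to what remains. The correction terms carry
variables of smaller index, so the moment Σ l·c_l decreases and the induction closes. -/
theorem highest_mem_degUP (hv : IsHighestVec μ v) {j : ℕ}
    (hj : ∀ (i : Fin n) (s : ℕ), s ≤ j → μ i + ∑ l, μ l - (i : ℕ) + s ≠ 0)
    (ih : degAV F n V j = degUP F n V j) (c : Fin n →₀ ℕ) (hc : c.degree = j + 1) :
    (monomial c 1 : PolyAlg F n) ⊗ₜ[F] v ∈ degUP F n V (j + 1) := by
  induction hM : ∑ l : Fin n, (l : ℕ) * c l using Nat.strong_induction_on generalizing c with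
  | _ M IH =>
    have hne : c.support.Nonempty := by
      rw [Finsupp.support_nonempty_iff]
      rintro rfl
      simp at hc
    let i := c.support.max' hne
    have hi : c i ≠ 0 := Finsupp.mem_support_iff.1 (c.support.max'_mem hne)
    have hmax : ∀ l, i < l → c l = 0 := fun l hl => by
      by_contra h
      exact absurd (c.support.le_max' l (Finsupp.mem_support_iff.2 h)) (not_le.2 hl)
    set d := c - Finsupp.single i 1 with hd
    have hcd : c = d + Finsupp.single i 1 := by
      ext l
      by_cases hl : l = i
      · subst hl; simp [hd]; omega
      · simp [hd, Finsupp.single_eq_of_ne hl]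
    have hdeg : d.degree = j := by
      rw [hcd, degree_add_single] at hc; omega
    have hdi : d i + 1 = c i := by rw [hcd]; simp
    have hMd : ∀ l : Fin n, ∑ r : Fin n, (r : ℕ) * (d + Finsupp.single l 1 : Fin n →₀ ℕ) r =
        ∑ r : Fin n, (r : ℕ) * d r + l := by
      intro l
      simp only [Finsupp.add_apply, mul_add, Finset.sum_add_distrib]
      congr 1
      rw [Finset.sum_eq_single l]
      · simp
      · intro r _ hr; simp [Finsupp.single_eq_of_ne hr]
      · simp
    have hsum : ∑ l ∈ Finset.Iio i, d l + d i = d.degree :=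
      sum_Iio_add_of_support d i fun l hl => by
        have := hmax l hl
        rw [hcd] at this
        simp at this
        exact this.1
    have key := wittRep_pt_highest hv i d
    -- Since d is supported on indices ≤ i, the degree cancels the sum of the earlier exponents and
    -- only d_i remains.
    have hcoef : (d.degree + ∑ j, μ j + μ i - ∑ l ∈ Finset.Iio i, ((d l : F) + 1)) =
        μ i + ∑ l, μ l - (i : ℕ) + d i := by
      rw [Finset.sum_add_distrib, Finset.sum_const, Fin.card_Iio, ← hsum]
      push_cast
      rw [nsmul_eq_mul]
      ring
    rw [hcoef, ← hcd] at key
    have h1 : wittRep F n V (pt F i) (monomial d 1 ⊗ₜ v) ∈ degUP F n V (j + 1) := by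
      refine wittRep_pt_mem_degUP i ?_
      rw [← ih]
      exact monomial_tmul_mem_degAV hdeg v
    have h2 : ∑ l ∈ Finset.Iio i, wittRep F n V (xpd F i l)
        ((monomial (d + Finsupp.single l 1) 1 : PolyAlg F n) ⊗ₜ[F] v) ∈ degUP F n V (j + 1) := by
      refine sum_mem fun l hl => wittRep_xpd_mem_degUP i l ?_
      have hl' : l < i := Finset.mem_Iio.1 hl
      have hl'' : (l : ℕ) < i := hl'
      refine IH _ ?_ _ (by rw [degree_add_single, hdeg]) rfl
      rw [← hM, hMd, hcd, hMd]
      omega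
    rw [key] at h1
    have h3 := (Submodule.add_mem_iff_left _ h2).1 h1
    have hle : d i ≤ j := by
      have : ∑ l ∈ Finset.Iio i, d l + d i = j := hsum.trans hdeg
      omega
    exact (Submodule.smul_mem_iff _ (hj i (d i) hle)).1 h3

/-- If no coefficient vanishes, then the degree pieces agree. -/
theorem degAV_eq_degUP (hv : IsHighestVec μ v) (j : ℕ)
    (hj : ∀ (i : Fin n) (s : ℕ), s < j → μ i + ∑ l, μ l - (i : ℕ) + s ≠ 0) :
    degAV F n V j = degUP F n V j := by
  induction j with
  | zero =>
    refine le_antisymm (degAV_le fun c y hc => ?_) (degUP_le_degAV 0)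
    have : c = 0 := (Finsupp.degree_eq_zero_iff c).1 hc
    subst this
    simpa using one_tmul_mem_degUP (F := F) (n := n) y
  | succ j ih =>
    have ih' := ih fun i s hs => hj i s (by omega)
    refine le_antisymm (degAV_le fun c y hc => ?_) (degUP_le_degAV _)
    -- All monomials of the degree are treated together because x_a ∂_b also changes the monomial.
    let S : Submodule F V :=
      { carrier := {y | ∀ c : Fin n →₀ ℕ, c.degree = j + 1 →
          (monomial c 1 : PolyAlg F n) ⊗ₜ[F] y ∈ degUP F n V (j + 1)}
        add_mem' := fun ha hb c hc => by
          rw [TensorProduct.tmul_add]; exact add_mem (ha c hc) (hb c hc)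
        zero_mem' := fun c _ => by rw [TensorProduct.tmul_zero]; exact zero_mem _
        smul_mem' := fun r y hy c hc => by
          rw [TensorProduct.tmul_smul]; exact Submodule.smul_mem _ _ (hy c hc) }
    refine highest_induction hv S (fun c hc =>
      highest_mem_degUP hv (fun i s hs => hj i s (by omega)) ih' c hc) (fun a b _ y hy c hc => ?_)
        y c hc
    have h1 := wittRep_xpd_mem_degUP a b (hy c hc)
    rw [wittRep_xpd_tmul] at h1
    obtain ⟨d, m, hd, h⟩ := xpd_monomial (F := F) a b c
    rw [h, ← TensorProduct.smul_tmul'] at h1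
    exact (Submodule.add_mem_iff_right _ (Submodule.smul_mem _ m (hy d (hd.trans hc)))).1 h1

/-- A vanishing coefficient at `x_i^k` is an obstruction to the equality of the degree pieces. -/
theorem degAV_ne_degUP [CharZero F] [Module.Finite F V] [NeZero n] (hv : IsHighestVec μ v)
    (i₀ : Fin n) (k : ℕ) (hk : μ i₀ + ∑ l, μ l - (i₀ : ℕ) + k = 0)
    (hdom : ∀ r : Fin n, (r : ℕ) + 1 = i₀ → ∃ m : ℕ, μ r - μ i₀ = (k + 1 : ℕ) + m) :
    degAV F n V (k + 1) ≠ degUP F n V (k + 1) := by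
  obtain ⟨lam, hlow, hne, hzero⟩ := exists_lowest_functional hv i₀ (k + 1) hdom
  have hP : ∀ (y : V) (i : Fin n) (c : Fin n →₀ ℕ), c.degree = k →
      lam (wittRep F n V (pt F i) (monomial c 1 ⊗ₜ y)) = 0 := by
    let S : Submodule F V :=
      { carrier := {y | ∀ (i : Fin n) (c : Fin n →₀ ℕ), c.degree = k →
          lam (wittRep F n V (pt F i) (monomial c 1 ⊗ₜ y)) = 0}
        add_mem' := fun ha hb i c hc => by
          rw [TensorProduct.tmul_add, map_add, map_add, ha i c hc, hb i c hc, add_zero]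
        zero_mem' := fun i c _ => by rw [TensorProduct.tmul_zero, map_zero, map_zero]
        smul_mem' := fun r y hy i c hc => by
          rw [TensorProduct.tmul_smul, map_smul, map_smul, hy i c hc, smul_zero] }
    refine highest_induction hv S (fun i c hc => ?_) (fun a b hab y hy i c hc => ?_)
    · have hz : lam (∑ l ∈ Finset.Iio i, wittRep F n V (xpd F i l)
          ((monomial (c + Finsupp.single l 1) 1 : PolyAlg F n) ⊗ₜ[F] v)) = 0 := by
        rw [map_sum]
        exact Finset.sum_eq_zero fun l hl => hlow i l (Finset.mem_Iio.1 hl) _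
      rw [wittRep_pt_highest hv, map_add, hz, add_zero, map_smul]
      -- The functional sees only x_{i₀}^{k+1} ⊗ v, reached exactly for i = i₀ and c = k ε_{i₀},
      -- where the coefficient is the vanishing number in `hk`.
      · by_cases h : c + Finsupp.single i 1 = Finsupp.single i₀ (k + 1)
        · have hi : i = i₀ := by
            by_contra hi
            have := DFunLike.congr_fun h i
            rw [Finsupp.single_eq_of_ne hi] at this
            simp at this
          subst hi
          have hc' : c = Finsupp.single i k := by
            rw [Finsupp.single_add] at h
            exact add_right_cancel h
          have hs : ∑ l ∈ Finset.Iio i, ((c l : F) + 1) = (i : ℕ) := by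
            rw [Finset.sum_congr rfl (g := fun _ => (1 : F)), Finset.sum_const, Fin.card_Iio,
              nsmul_eq_mul, mul_one]
            intro l hl
            rw [hc', Finsupp.single_eq_of_ne (Finset.mem_Iio.1 hl).ne]
            simp
          have h0 : ((c.degree : F) + ∑ j, μ j + μ i -
              ∑ l ∈ Finset.Iio i, ((c l : F) + 1)) = 0 := by
            rw [hs, hc, ← hk]; ring
          rw [h0, zero_smul]
        · rw [hzero _ h, smul_zero]
    -- Commuting x_a ∂_b past p_i expresses the value at E_{a,b} y through values at y, which are
    -- zero.
    · have h1 := hlow a b hab (wittRep F n V (pt F i) (monomial c 1 ⊗ₜ y))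
      rw [wittRep_xpd_pt, wittRep_xpd_tmul, map_add, map_add, map_add] at h1
      obtain ⟨d, m, hd, h⟩ := xpd_monomial (F := F) a b c
      rw [h, ← TensorProduct.smul_tmul', map_smul, map_smul, hy i d (hd.trans hc), smul_zero,
        zero_add] at h1
      have h2 : lam (if b = i then wittRep F n V (pt F a) (monomial c 1 ⊗ₜ y) else 0) = 0 := by
        split_ifs
        · exact hy a c hc
        · exact map_zero _
      rw [h2, add_zero] at h1
      exact h1
  have hker : degUP F n V (k + 1) ≤ LinearMap.ker lam := by
    refine degUP_succ_le fun i w hw => ?_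
    have : degAV F n V k ≤ (LinearMap.ker lam).comap (wittRep F n V (pt F i)) :=
      degAV_le fun c y hc => hP y i c hc
    exact this (degUP_le_degAV k hw)
  intro h
  have hmem : (monomial (Finsupp.single i₀ (k + 1)) 1 : PolyAlg F n) ⊗ₜ[F] v ∈
      degAV F n V (k + 1) := monomial_tmul_mem_degAV (Finsupp.degree_single _ _) v
  rw [h] at hmem
  exact hne (hker hmem)

-- ∂_0 lowers both filtrations by one degree and recovers x^c from x_0 x^c up to the nonzero factor
-- c_0 + 1.
omit [LieModule.IsIrreducible F (Gl F n) V] in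
theorem degAV_eq_degUP_of_succ [CharZero F] [NeZero n] {j : ℕ}
    (h : degAV F n V (j + 1) = degUP F n V (j + 1)) : degAV F n V j = degUP F n V j := by
  refine le_antisymm (degAV_le fun c y hc => ?_) (degUP_le_degAV j)
  let b : Fin n := 0
  have h1 : (monomial (c + Finsupp.single b 1) 1 : PolyAlg F n) ⊗ₜ[F] y ∈ degUP F n V (j + 1) := by
    rw [← h]
    exact monomial_tmul_mem_degAV (by rw [degree_add_single, hc]) y
  have h2 := wittRep_pd_mem_degUP b h1
  rw [wittRep_pd_tmul, pd, pderiv_monomial, add_tsub_cancel_right, one_mul, monomial_eq_smul_one,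
    ← TensorProduct.smul_tmul'] at h2
  refine (Submodule.smul_mem_iff _ ?_).1 h2
  rw [Finsupp.add_apply, Finsupp.single_eq_same]
  exact Nat.cast_ne_zero.2 (Nat.succ_ne_zero _)

omit [LieModule.IsIrreducible F (Gl F n) V] in
theorem degAV_ne_degUP_of_le [CharZero F] [NeZero n] {i j : ℕ} (hij : i ≤ j)
    (h : degAV F n V i ≠ degUP F n V i) : degAV F n V j ≠ degUP F n V j := by
  induction j, hij using Nat.le_induction with
  | base => exact h
  | succ j _ ih => exact fun h' => ih (degAV_eq_degUP_of_succ h')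

end Comparison

/-! ### U(P)(1 ⊗ V) as an irreducible L_{n+1}-module -/

section EnvelopingSubmodule

open MvPolynomial

variable {F : Type*} [Field F] {n : ℕ}
  {V : Type*} [AddCommGroup V] [Module F V]
  [LieRingModule (Gl F n) V] [LieModule F (Gl F n) V]

theorem wittRep_mem_of_span {G : Set (Witt F n)} {S T : Submodule F (PolyAlg F n ⊗[F] V)}
    (h : ∀ D ∈ G, ∀ w ∈ S, wittRep F n V D w ∈ T) {D : Witt F n} (hD : D ∈ Submodule.span F G)
    {w : PolyAlg F n ⊗[F] V} (hw : w ∈ S) : wittRep F n V D w ∈ T := by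
  induction hD using Submodule.span_induction with
  | mem D hD => exact h D hD w hw
  | zero => rw [map_zero]; exact zero_mem _
  | add D D' _ _ h1 h2 => rw [map_add]; exact add_mem h1 h2
  | smul c D _ h1 => rw [map_smul]; exact Submodule.smul_mem _ _ h1

/-- The enveloping algebra is a quotient of the tensor algebra, so stability is checked on
generators and products. -/
theorem lift_mem_of_stable {S : Submodule F (PolyAlg F n ⊗[F] V)}
    (hS : ∀ a, ∀ w ∈ S, wittRep F n V (pt F a) w ∈ S)
    (u : UniversalEnvelopingAlgebra F (pseudoTrans F n)) {w : PolyAlg F n ⊗[F] V} (hw : w ∈ S) :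
    UniversalEnvelopingAlgebra.lift F
      (LieModule.toEnd F (pseudoTrans F n) (PolyAlg F n ⊗[F] V)) u w ∈ S := by
  have hx : ∀ x : pseudoTrans F n, ∀ w ∈ S, wittRep F n V x w ∈ S := fun x w hw =>
    wittRep_mem_of_span (G := Set.range (pt F)) (by rintro _ ⟨a, rfl⟩ w hw; exact hS a w hw) x.2 hw
  obtain ⟨t, rfl⟩ : ∃ t, UniversalEnvelopingAlgebra.mkAlgHom F (pseudoTrans F n) t = u :=
    RingCon.mk'_surjective _ u
  induction t using TensorAlgebra.induction generalizing w with
  | algebraMap c =>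
    rw [AlgHom.commutes, AlgHom.commutes]
    exact Submodule.smul_mem _ c hw
  | ι x =>
    rw [UniversalEnvelopingAlgebra.lift_ι_apply']
    exact hx x w hw
  | mul a b ha hb =>
    rw [map_mul, map_mul]
    exact ha (hb hw)
  | add a b ha hb =>
    rw [map_add, map_add]
    exact add_mem (ha hw) (hb hw)

theorem UP_le_of_stable {S : Submodule F (PolyAlg F n ⊗[F] V)}
    (h1 : ∀ y : V, (1 : PolyAlg F n) ⊗ₜ[F] y ∈ S)
    (hS : ∀ a, ∀ w ∈ S, wittRep F n V (pt F a) w ∈ S) : UP F n V ≤ S := by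
  refine Submodule.span_le.2 ?_
  rintro _ ⟨u, y, rfl⟩
  exact lift_mem_of_stable hS u (h1 y)

theorem one_tmul_mem_UP (y : V) : (1 : PolyAlg F n) ⊗ₜ[F] y ∈ UP F n V :=
  Submodule.subset_span ⟨1, y, by rw [map_one]; rfl⟩

theorem wittRep_pt_mem_UP (a : Fin n) {w : PolyAlg F n ⊗[F] V} (hw : w ∈ UP F n V) :
    wittRep F n V (pt F a) w ∈ UP F n V := by
  have : UP F n V ≤ (UP F n V).comap (wittRep F n V (pt F a)) := by
    refine Submodule.span_le.2 ?_
    rintro _ ⟨u, y, rfl⟩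
    let x : pseudoTrans F n := ⟨pt F a, Submodule.subset_span ⟨a, rfl⟩⟩
    refine Submodule.subset_span ⟨UniversalEnvelopingAlgebra.ι F x * u, y, ?_⟩
    rw [map_mul, UniversalEnvelopingAlgebra.lift_ι_apply]
    rfl
  exact this hw

theorem degUP_le_UP (k : ℕ) : degUP F n V k ≤ UP F n V := by
  induction k with
  | zero => exact degUP_zero_le one_tmul_mem_UP
  | succ k ih => exact degUP_succ_le fun a w hw => wittRep_pt_mem_UP a (ih hw)

theorem UP_eq_iSup : UP F n V = ⨆ k, degUP F n V k := by
  refine le_antisymm (UP_le_of_stable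
    (fun y => Submodule.mem_iSup_of_mem 0 (one_tmul_mem_degUP y)) fun a w hw => ?_)
    (iSup_le degUP_le_UP)
  have : (⨆ k, degUP F n V k) ≤ (⨆ k, degUP F n V k).comap (wittRep F n V (pt F a)) :=
    iSup_le fun k w hw => Submodule.mem_iSup_of_mem (k + 1) (wittRep_pt_mem_degUP a hw)
  exact this hw

theorem wittRep_mem_UP {D : Witt F n} (hD : D ∈ projGens F n) {w : PolyAlg F n ⊗[F] V}
    (hw : w ∈ UP F n V) : wittRep F n V D w ∈ UP F n V := by
  have key : UP F n V ≤ (UP F n V).comap (wittRep F n V D) := by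
    conv_lhs => rw [UP_eq_iSup]
    refine iSup_le fun k w hw => ?_
    rw [Submodule.mem_comap]
    rcases hD with ⟨i, j, rfl⟩ | ⟨i, rfl⟩ | ⟨i, rfl⟩
    · exact degUP_le_UP k (wittRep_xpd_mem_degUP i j hw)
    · cases k with
      | zero => rw [wittRep_pd_degUP_zero i hw]; exact zero_mem _
      | succ k => exact degUP_le_UP k (wittRep_pd_mem_degUP i hw)
    · exact degUP_le_UP (k + 1) (wittRep_pt_mem_degUP i hw)
  exact key hw

variable (F n V) in
/-- `U(P)(1 ⊗ V)` as a submodule over `L_{n+1}`. -/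
def UPLie : LieSubmodule F (projLie F n) (PolyAlg F n ⊗[F] V) :=
  { UP F n V with
    lie_mem := fun {x _} hm =>
      wittRep_mem_of_span (S := UP F n V) (fun _ hD _ hw => wittRep_mem_UP hD hw) x.2 hm }

omit [LieRingModule (Gl F n) V] [LieModule F (Gl F n) V] in
theorem eq_zero_of_one_tmul {y : V} (h : (1 : PolyAlg F n) ⊗ₜ[F] y = 0) : y = 0 := by
  have := congrArg (TensorProduct.lid F V ∘ LinearMap.rTensor V (lcoeff F (0 : Fin n →₀ ℕ))) h
  simpa using this

omit [LieRingModule (Gl F n) V] [LieModule F (Gl F n) V] in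
theorem exists_C_of_pderiv_eq_zero [CharZero F] {f : PolyAlg F n} (h : ∀ b, pd F b f = 0) :
    ∃ a : F, f = C a := by
  refine ⟨coeff 0 f, ?_⟩
  ext c
  rw [coeff_C]
  split_ifs with hc
  · rw [hc]
  · obtain ⟨b, hb⟩ : ∃ b, c b ≠ 0 := by
      by_contra! h0
      exact hc (Finsupp.ext fun b => (h0 b).symm)
    have hcd : c - Finsupp.single b 1 + Finsupp.single b 1 = c := by
      ext l
      by_cases hl : l = b
      · subst hl; simp; omega
      · simp [Finsupp.single_eq_of_ne hl]
    have h1 := congrArg (coeff (c - Finsupp.single b 1)) (h b)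
    rw [pd, coeff_pderiv, hcd, coeff_zero] at h1
    exact (mul_eq_zero.1 h1).resolve_right (Nat.cast_add_one_ne_zero _)

/-- In a basis of V, the coordinates are polynomials with zero gradient, hence constants in
characteristic 0. -/
theorem exists_eq_one_tmul [CharZero F] {w : PolyAlg F n ⊗[F] V}
    (h : ∀ b, wittRep F n V (pd F b) w = 0) : ∃ y : V, w = 1 ⊗ₜ[F] y := by
  classical
  let B := Module.Basis.ofVectorSpace F V
  let φ := TensorProduct.equivFinsuppOfBasisRight (M := PolyAlg F n) B
  have hφ : ∀ b (w : PolyAlg F n ⊗[F] V) s, φ (wittRep F n V (pd F b) w) s = pd F b (φ w s) := by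
    intro b w s
    induction w using TensorProduct.induction_on with
    | zero => simp
    | add x y hx hy => simp only [map_add, Finsupp.add_apply, hx, hy]
    | tmul f y =>
      rw [wittRep_pd_tmul, TensorProduct.equivFinsuppOfBasisRight_apply_tmul_apply,
        TensorProduct.equivFinsuppOfBasisRight_apply_tmul_apply, Derivation.map_smul]
  have h1 : ∀ s, ∃ a : F, φ w s = C a := fun s =>
    exists_C_of_pderiv_eq_zero fun b => by rw [← hφ, h]; simp
  choose a ha using h1
  refine ⟨∑ s ∈ (φ w).support, a s • B s, ?_⟩
  have h2 : w = φ.symm (φ w) := (φ.symm_apply_apply w).symm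
  conv_lhs => rw [h2]
  rw [TensorProduct.equivFinsuppOfBasisRight_symm_apply, Finsupp.sum, TensorProduct.tmul_sum]
  refine Finset.sum_congr rfl fun s _ => ?_
  rw [ha, ← mul_one (C (a s)), ← smul_eq_C_mul, TensorProduct.smul_tmul]

variable (F n V) in
/-- The vectors killed by all products of `d` partial derivatives. -/
def derKernel : ℕ → Submodule F (PolyAlg F n ⊗[F] V)
  | 0 => ⊥
  | d + 1 => ⨅ b, (derKernel d).comap (wittRep F n V (pd F b))

theorem mem_derKernel_succ {d : ℕ} {w : PolyAlg F n ⊗[F] V} :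
    w ∈ derKernel F n V (d + 1) ↔ ∀ b, wittRep F n V (pd F b) w ∈ derKernel F n V d := by
  simp [derKernel, Submodule.mem_iInf]

theorem degAV_le_derKernel (j : ℕ) : degAV F n V j ≤ derKernel F n V (j + 1) := by
  induction j with
  | zero =>
    refine degAV_le fun c y hc => mem_derKernel_succ.2 fun b => ?_
    have : c = 0 := (Finsupp.degree_eq_zero_iff c).1 hc
    subst this
    rw [wittRep_pd_tmul, pd, pderiv_monomial]
    simp
  | succ j ih => exact fun w hw => mem_derKernel_succ.2 fun b => ih (wittRep_pd_mem_degAV b hw)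

theorem derKernel_mono : Monotone (derKernel F n V) := by
  refine monotone_nat_of_le_succ fun d => ?_
  induction d with
  | zero => exact bot_le
  | succ d ih => exact fun w hw => mem_derKernel_succ.2 fun b => ih (mem_derKernel_succ.1 hw b)

theorem exists_mem_derKernel (w : PolyAlg F n ⊗[F] V) : ∃ d, w ∈ derKernel F n V d := by
  induction w using TensorProduct.induction_on with
  | zero => exact ⟨0, zero_mem _⟩
  | add x y hx hy =>
    obtain ⟨d, hd⟩ := hx
    obtain ⟨d', hd'⟩ := hy
    exact ⟨max d d', add_mem (derKernel_mono (le_max_left _ _) hd)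
      (derKernel_mono (le_max_right _ _) hd')⟩
  | tmul f y =>
    induction f using MvPolynomial.induction_on' with
    | monomial c a =>
      refine ⟨c.degree + 1, ?_⟩
      rw [monomial_eq_smul_one, ← TensorProduct.smul_tmul']
      exact Submodule.smul_mem _ _ (degAV_le_derKernel _ (monomial_tmul_mem_degAV rfl y))
    | add p q hp hq =>
      obtain ⟨d, hd⟩ := hp
      obtain ⟨d', hd'⟩ := hq
      rw [TensorProduct.add_tmul]
      exact ⟨max d d', add_mem (derKernel_mono (le_max_left _ _) hd)
        (derKernel_mono (le_max_right _ _) hd')⟩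

/-- A nonzero subspace stable under the partial derivatives meets `1 ⊗ V`. -/
theorem exists_one_tmul_mem [CharZero F] {S : Submodule F (PolyAlg F n ⊗[F] V)}
    (hS : ∀ b, ∀ w ∈ S, wittRep F n V (pd F b) w ∈ S) {w : PolyAlg F n ⊗[F] V} (hw : w ∈ S)
    (h0 : w ≠ 0) : ∃ y : V, y ≠ 0 ∧ (1 : PolyAlg F n) ⊗ₜ[F] y ∈ S := by
  obtain ⟨d, hd⟩ := exists_mem_derKernel w
  induction d generalizing w with
  | zero => exact absurd hd h0
  | succ d ih =>
    by_cases h : ∀ b, wittRep F n V (pd F b) w = 0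
    · obtain ⟨y, rfl⟩ := exists_eq_one_tmul h
      refine ⟨y, ?_, hw⟩
      rintro rfl
      exact h0 (TensorProduct.tmul_zero _ _)
    · push Not at h
      obtain ⟨b, hb⟩ := h
      exact ih (hS b w hw) hb (mem_derKernel_succ.1 hd b)

variable [LieModule.IsIrreducible F (Gl F n) V]

/-- Derivatives produce some 1 ⊗ y ≠ 0 in S. On 1 ⊗ V the operators x_i ∂_j act as E_{i,j}, so
irreducibility of V gives all of 1 ⊗ V, and stability under P gives the rest. -/
theorem UP_le_of_projGens_stable [CharZero F] {S : Submodule F (PolyAlg F n ⊗[F] V)}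
    (hS : ∀ D ∈ projGens F n, ∀ w ∈ S, wittRep F n V D w ∈ S) {w : PolyAlg F n ⊗[F] V}
    (hw : w ∈ S) (h0 : w ≠ 0) : UP F n V ≤ S := by
  obtain ⟨y, hy0, hy⟩ := exists_one_tmul_mem (fun b => hS _ (Or.inr (Or.inl ⟨b, rfl⟩))) hw h0
  let T : Submodule F V := S.comap (TensorProduct.mk F (PolyAlg F n) V 1)
  have hE : ∀ i j, ∀ z ∈ T, ⁅E F i j, z⁆ ∈ T := fun i j z hz => by
    have := hS _ (Or.inl ⟨i, j, rfl⟩) _ hz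
    rw [TensorProduct.mk_apply, wittRep_xpd_tmul, Derivation.map_one_eq_zero,
      TensorProduct.zero_tmul, zero_add] at this
    exact this
  let N : LieSubmodule F (Gl F n) V :=
    { T with
      lie_mem := by
        intro x m hm
        change ⁅x, m⁆ ∈ T
        rw [Matrix.matrix_eq_sum_single x, sum_lie]
        refine sum_mem fun i _ => ?_
        rw [sum_lie]
        refine sum_mem fun j _ => ?_
        have : Matrix.single i j (x i j) = x i j • E F i j := by simp [E]
        rw [this, smul_lie]
        exact Submodule.smul_mem _ _ (hE i j m hm) }
  have : Nontrivial N := ⟨⟨⟨y, hy⟩, 0, fun h => hy0 (congrArg Subtype.val h)⟩⟩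
  have hN := LieSubmodule.eq_top_of_isIrreducible F (Gl F n) V N
  refine UP_le_of_stable (fun z => ?_) fun a => hS _ (Or.inr (Or.inr ⟨a, rfl⟩))
  have : z ∈ N := by rw [hN]; trivial
  exact this

theorem isIrreducible_UPLie [CharZero F] :
    LieModule.IsIrreducible F (projLie F n) (UPLie F n V) := by
  have hV : Nontrivial V := LieModule.nontrivial_of_isIrreducible F (Gl F n) V
  obtain ⟨y, hy⟩ := exists_ne (0 : V)
  have hne : (1 : PolyAlg F n) ⊗ₜ[F] y ≠ 0 := fun h => hy (eq_zero_of_one_tmul h)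
  have : Nontrivial (UPLie F n V) :=
    ⟨⟨⟨_, one_tmul_mem_UP y⟩, 0, fun h => hne (congrArg Subtype.val h)⟩⟩
  refine LieModule.IsIrreducible.mk fun N hN => ?_
  obtain ⟨w, hw, hw0⟩ : ∃ w ∈ N, w ≠ 0 := by
    by_contra! h
    exact hN ((LieSubmodule.eq_bot_iff N).2 h)
  have hle : UP F n V ≤ N.toSubmodule.map (UPLie F n V).toSubmodule.subtype := by
    refine UP_le_of_projGens_stable (w := w) ?_ ⟨w, hw, rfl⟩ fun h => hw0 (Subtype.ext h)
    rintro D hD _ ⟨z, hz, rfl⟩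
    let x : projLie F n := ⟨D, Submodule.subset_span hD⟩
    let z' : UPLie F n V := z
    let y : UPLie F n V := ⁅x, z'⁆
    exact ⟨y, N.lie_mem hz, rfl⟩
  rw [eq_top_iff]
  rintro z -
  obtain ⟨z', hz', h⟩ := hle z.2
  rwa [← Subtype.ext h]

end EnvelopingSubmodule

/-! ### Nilpotency of p_0 and finite dimension -/

section FiniteDimensional

open MvPolynomial

variable {F : Type*} [Field F] {n : ℕ}
  {V : Type*} [AddCommGroup V] [Module F V]
  [LieRingModule (Gl F n) V] [LieModule F (Gl F n) V]

theorem wittRep_pt_pow_comm (a i : Fin n) (m : ℕ) (w : PolyAlg F n ⊗[F] V) :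
    wittRep F n V (pt F a) ((wittRep F n V (pt F i) ^ m) w) =
      (wittRep F n V (pt F i) ^ m) (wittRep F n V (pt F a) w) :=
  LinearMap.congr_fun ((wittRep_pt_comm (V := V) a i).pow_right m).eq w

theorem wittRep_xpd_pt_pow (a b i : Fin n) (m : ℕ) (w : PolyAlg F n ⊗[F] V) :
    wittRep F n V (xpd F a b) ((wittRep F n V (pt F i) ^ (m + 1)) w) =
      (wittRep F n V (pt F i) ^ (m + 1)) (wittRep F n V (xpd F a b) w) +
        (m + 1 : F) • if b = i then wittRep F n V (pt F a) ((wittRep F n V (pt F i) ^ m) w)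
          else 0 := by
  induction m with
  | zero => simp [wittRep_xpd_pt]
  | succ m ih =>
    rw [pow_succ', Module.End.mul_apply, wittRep_xpd_pt, ih, map_add, map_smul,
      ← Module.End.mul_apply, ← pow_succ', add_assoc]
    congr 1
    split_ifs with h
    · rw [wittRep_pt_pow_comm a i, wittRep_pt_pow_comm a i, ← Module.End.mul_apply, ← pow_succ',
        Nat.cast_add, Nat.cast_one]
      module
    · simp

/-- Polarization: applying x_a ∂_i to p_i^{m+1} w = 0 gives (m+1) p_a p_i^m w = 0, so powers of p_i
can be exchanged one at a time for arbitrary factors. -/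
theorem degUP_eq_bot_of_pow_eq_zero [CharZero F] (i : Fin n) (J : ℕ)
    (h : ∀ y : V, (wittRep F n V (pt F i) ^ J) (1 ⊗ₜ y) = 0) : degUP F n V J = ⊥ := by
  have key : ∀ r m : ℕ, r + m = J → degUP F n V r ≤ LinearMap.ker (wittRep F n V (pt F i) ^ m) := by
    intro r
    induction r with
    | zero =>
      intro m hm
      rw [zero_add] at hm
      subst hm
      exact degUP_zero_le fun y => h y
    | succ r ih =>
      intro m hm
      have ih' := ih (m + 1) (by omega)
      refine degUP_succ_le fun a w hw => ?_
      have h1 := wittRep_xpd_pt_pow a i i m w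
      rw [if_pos rfl, LinearMap.mem_ker.1 (ih' hw),
        LinearMap.mem_ker.1 (ih' (wittRep_xpd_mem_degUP a i hw)), map_zero, zero_add] at h1
      rw [LinearMap.mem_ker, ← wittRep_pt_pow_comm]
      exact (smul_eq_zero.1 h1.symm).resolve_left (Nat.cast_add_one_ne_zero m)
  rw [eq_bot_iff]
  intro w hw
  simpa using key J 0 rfl hw

theorem degUP_eq_bot_of_le {J k : ℕ} (h : degUP F n V J = ⊥) (hJ : J ≤ k) :
    degUP F n V k = ⊥ := by
  induction k, hJ using Nat.le_induction with
  | base => exact h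
  | succ k _ ih =>
    rw [eq_bot_iff]
    refine degUP_succ_le fun a w hw => ?_
    rw [ih, Submodule.mem_bot] at hw
    rw [hw, map_zero]
    exact zero_mem _

theorem finite_degUP [Module.Finite F V] (k : ℕ) : Module.Finite F (degUP F n V k) := by
  induction k with
  | zero =>
    exact Submodule.finiteDimensional_of_le (S₂ := (TensorProduct.mk F (PolyAlg F n) V 1).range)
      (degUP_zero_le fun y => ⟨y, rfl⟩)
  | succ k ih =>
    refine Submodule.finiteDimensional_of_le
      (S₂ := ⨆ a, (degUP F n V k).map (wittRep F n V (pt F a))) ?_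
    exact degUP_succ_le fun a w hw => Submodule.mem_iSup_of_mem a ⟨w, hw, rfl⟩

theorem finite_UP_of_degUP_eq_bot [Module.Finite F V] {J : ℕ} (h : degUP F n V J = ⊥) :
    Module.Finite F (UP F n V) := by
  have := finite_degUP (F := F) (n := n) (V := V)
  refine Submodule.finiteDimensional_of_le (S₂ := ⨆ j : Fin J, degUP F n V j) ?_
  rw [UP_eq_iSup]
  refine iSup_le fun k => ?_
  by_cases hk : k < J
  · exact le_iSup (fun j : Fin J => degUP F n V j) ⟨k, hk⟩
  · rw [degUP_eq_bot_of_le h (not_lt.1 hk)]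
    exact bot_le

/-- No lower index precedes 0, so p_0 acts on the vectors x_0^m ⊗ v by pure scalars, the one at m =
k being zero. Lowering costs at most one further power, and finite dimension of V bounds the
exponent uniformly. -/
theorem finite_UP [CharZero F] [Module.Finite F V] [LieModule.IsIrreducible F (Gl F n) V]
    [NeZero n] {μ : Fin n → F} {v : V} (hv : IsHighestVec μ v) {k : ℕ}
    (hk : μ 0 + ∑ j, μ j = -(k : F)) : Module.Finite F (UP F n V) := by
  let P := wittRep F n V (pt F 0)
  have hpow : ∀ m, ∃ a : F, (P ^ m) (1 ⊗ₜ v) =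
      a • (monomial (Finsupp.single 0 m) 1 : PolyAlg F n) ⊗ₜ[F] v := by
    intro m
    induction m with
    | zero => exact ⟨1, by simp⟩
    | succ m ih =>
      obtain ⟨a, ha⟩ := ih
      refine ⟨a * (m + ∑ j, μ j + μ 0), ?_⟩
      rw [pow_succ', Module.End.mul_apply, ha, map_smul, wittRep_pt_highest hv]
      have h0 : Finset.Iio (0 : Fin n) = ∅ := by
        ext l
        simp
      rw [h0, Finset.sum_empty, Finset.sum_empty, sub_zero, add_zero, smul_smul,
        Finsupp.degree_single, ← Finsupp.single_add]
  let S : ℕ →o Submodule F V :=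
    { toFun := fun j => (LinearMap.ker (P ^ j)).comap (TensorProduct.mk F (PolyAlg F n) V 1)
      monotone' := monotone_nat_of_le_succ fun j y hy => by
        rw [Submodule.mem_comap, LinearMap.mem_ker] at hy ⊢
        rw [pow_succ', Module.End.mul_apply, hy, map_zero] }
  have hS : ∀ j y, y ∈ S j ↔ (P ^ j) (1 ⊗ₜ y) = 0 := fun j y => Iff.rfl
  have hmem : ∀ y, y ∈ ⨆ j, S j := by
    refine highest_induction hv _ ?_ fun a b hba y hy => ?_
    · refine Submodule.mem_iSup_of_mem (k + 1) ((hS _ _).2 ?_)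
      obtain ⟨a, ha⟩ := hpow k
      rw [pow_succ', Module.End.mul_apply, ha, map_smul, wittRep_pt_highest hv]
      have h0 : Finset.Iio (0 : Fin n) = ∅ := by
        ext l
        simp
      rw [h0, Finset.sum_empty, Finset.sum_empty, sub_zero, add_zero, Finsupp.degree_single,
        add_assoc, add_comm (∑ j, μ j), hk, add_neg_cancel, zero_smul, smul_zero]
    · rw [Submodule.mem_iSup_of_directed _ S.monotone.directed_le] at hy
      obtain ⟨j, hj⟩ := hy
      refine Submodule.mem_iSup_of_mem (j + 1) ((hS _ _).2 ?_)
      have hj' : (P ^ (j + 1)) (1 ⊗ₜ y) = 0 := (hS _ _).1 (S.monotone j.le_succ hj)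
      -- The commutator with p_0^{j+1} still contains p_0^j, which already kills 1 ⊗ y.
      have h1 := wittRep_xpd_pt_pow a b 0 j ((1 : PolyAlg F n) ⊗ₜ[F] y)
      rw [hj', (hS _ _).1 hj, map_zero, map_zero, ite_self, smul_zero, add_zero, wittRep_xpd_tmul,
        Derivation.map_one_eq_zero, TensorProduct.zero_tmul, zero_add] at h1
      exact h1.symm
  obtain ⟨J, hJ⟩ := monotone_stabilizes_iff_noetherian.2 (inferInstance : IsNoetherian F V) S
  refine finite_UP_of_degUP_eq_bot (degUP_eq_bot_of_pow_eq_zero 0 J fun y => ?_)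
  have := hmem y
  rw [Submodule.mem_iSup_of_directed _ S.monotone.directed_le] at this
  obtain ⟨j, hj⟩ := this
  rcases le_total j J with h | h
  · exact (hS _ _).1 (S.monotone h hj)
  · rw [← hS, hJ j h]
    exact hj

end FiniteDimensional

/-! ### Extremal vectors and the highest weight of U(P)(1 ⊗ V) -/

section HighestWeight

open MvPolynomial

variable {F : Type*} [Field F] {n : ℕ}
  {V : Type*} [AddCommGroup V] [Module F V]
  [LieRingModule (Gl F n) V] [LieModule F (Gl F n) V]

/-- The signs make p_r the lowering element, so vectors killed by ∂_r are primitive. -/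
theorem isSl2Triple_projLie [CharZero F] (r : Fin n) : IsSl2Triple (L := projLie F n)
    (-⟨xpd F r r + euler F n, add_mem (xpd_mem_span F r r) (euler_mem_span F)⟩)
    (-⟨pd F r, pd_mem_span F r⟩) ⟨pt F r, pt_mem_span F r⟩ := by
  refine ⟨fun h => ?_, Subtype.ext ?_, Subtype.ext ?_, Subtype.ext ?_⟩
  · have h1 := congrArg (fun x : projLie F n => (x : Witt F n) (X r)) (neg_eq_zero.1 h)
    simp only [Derivation.add_apply, xpd_X, euler_X, if_true] at h1
    have h2 := congrArg (coeff (Finsupp.single r 1)) h1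
    simp [coeff_X] at h2
  · change ⁅-pd F r, pt F r⁆ = -(xpd F r r + euler F n)
    apply derivation_ext
    intro l
    simp only [Derivation.commutator_apply, pd_X, pt_X, Derivation.add_apply, Derivation.neg_apply,
      xpd_X, euler_X]
    split_ifs with h <;> simp [h, pd_X]
  · change ⁅-(xpd F r r + euler F n), -pd F r⁆ = 2 • -pd F r
    apply derivation_ext
    intro l
    simp only [Derivation.commutator_apply, Derivation.neg_apply, pd_X, Derivation.add_apply,
      xpd_X, euler_X, map_add, map_neg, two_smul]
    split_ifs with h <;> simp [h, pd_X]
  · change ⁅-(xpd F r r + euler F n), pt F r⁆ = -(2 • pt F r)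
    apply derivation_ext
    intro l
    simp only [Derivation.commutator_apply, pt_X, Derivation.add_apply,
      xpd_X, euler_X, Derivation.leibniz, Derivation.neg_apply]
    split_ifs with h <;> simp [h, pt_X, two_smul] <;> ring

/-- The `sl(2)`-string through a vector of `U(P)(1 ⊗ V)` in the direction of `p_r`. -/
theorem exists_pt_string [CharZero F] [Module.Finite F (UP F n V)] (r : Fin n) {a b : F}
    {w : PolyAlg F n ⊗[F] V} (hw : w ∈ UP F n V) (h0 : w ≠ 0)
    (hd : wittRep F n V (pd F r) w = 0) (hx : wittRep F n V (xpd F r r) w = a • w)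
    (he : wittRep F n V (euler F n) w = b • w) :
    ∃ M : ℕ, -(a + b) = M ∧ (wittRep F n V (pt F r) ^ M) w ≠ 0 ∧
      (wittRep F n V (pt F r) ^ (M + 1)) w = 0 := by
  have : IsNoetherian F (UPLie F n V) := isNoetherian_of_isNoetherianRing_of_finite F (UP F n V)
  let w' : UPLie F n V := ⟨w, hw⟩
  have P : (isSl2Triple_projLie (F := F) r).HasPrimitiveVectorWith w' (-(a + b)) := by
    refine ⟨fun h => h0 (congrArg Subtype.val h), Subtype.ext ?_, Subtype.ext ?_⟩
    · change wittRep F n V (-(xpd F r r + euler F n)) w = -(a + b) • w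
      rw [map_neg, map_add, LinearMap.neg_apply, LinearMap.add_apply, hx, he]
      module
    · change wittRep F n V (-pd F r) w = 0
      rw [map_neg, LinearMap.neg_apply, hd, neg_zero]
  obtain ⟨M, hM⟩ := P.exists_nat
  have hpow : ∀ m, (((LieModule.toEnd F (projLie F n) (UPLie F n V)
      ⟨pt F r, pt_mem_span F r⟩ ^ m) w' : UPLie F n V) : PolyAlg F n ⊗[F] V) =
      (wittRep F n V (pt F r) ^ m) w := by
    intro m
    induction m with
    | zero => rfl
    | succ m ih =>
      rw [pow_succ', Module.End.mul_apply, pow_succ', Module.End.mul_apply, ← ih]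
      rfl
  refine ⟨M, hM, fun h => ?_, ?_⟩
  · exact P.pow_toEnd_f_ne_zero_of_eq_nat hM le_rfl (Subtype.ext ((hpow M).trans h))
  · rw [← hpow, P.pow_toEnd_f_eq_zero_of_eq_nat hM]
    rfl

/-- A vector of `𝒜 ⊗ V` is `r`-extremal if it is killed by the positive root vectors of the Borel
subalgebra of `L_{n+1}` obtained from the one containing all `∂_l` by `r` successive reflections in
the roots of `p_0, …, p_{r-1}`. -/
structure IsExtremal (r : ℕ) (w : PolyAlg F n ⊗[F] V) : Prop where
  pt : ∀ l : Fin n, (l : ℕ) < r → wittRep F n V (pt F l) w = 0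
  pd : ∀ l : Fin n, r ≤ l → wittRep F n V (pd F l) w = 0
  raise : ∀ a b : Fin n, a < b → wittRep F n V (xpd F a b) w = 0

/-- The new vector is the end of the p_r-string through w. Brackets of p_r with the other
annihilators give annihilators again: [x_a ∂_r, p_r] = p_a for a < r and [∂_l, p_r] = x_r ∂_l for l
> r. -/
theorem IsExtremal.step [CharZero F] [Module.Finite F (UP F n V)] (r : Fin n) {κ : Fin n → F}
    {w : PolyAlg F n ⊗[F] V} (h : IsExtremal r w) (hw : w ∈ UP F n V) (h0 : w ≠ 0)
    (hκ : ∀ a, wittRep F n V (xpd F a a) w = κ a • w) :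
    ∃ w' : PolyAlg F n ⊗[F] V, IsExtremal (r + 1) w' ∧ w' ∈ UP F n V ∧ w' ≠ 0 ∧
      ∀ a, wittRep F n V (xpd F a a) w' = (if a = r then -∑ l, κ l else κ a) • w' := by
  have he : wittRep F n V (euler F n) w = (∑ l, κ l) • w := by
    rw [wittRep_euler, Finset.sum_congr rfl fun a _ => hκ a, Finset.sum_smul]
  obtain ⟨M, hM, hne, hzero⟩ := exists_pt_string r hw h0 (h.pd r le_rfl) (hκ r) he
  have key : ∀ m : ℕ, (wittRep F n V (GenProj.pt F r) ^ m) w ∈ UP F n V ∧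
      (∀ l : Fin n, (l : ℕ) < r →
        wittRep F n V (GenProj.pt F l) ((wittRep F n V (GenProj.pt F r) ^ m) w) = 0) ∧
      (∀ l : Fin n, (r : ℕ) < l →
        wittRep F n V (GenProj.pd F l) ((wittRep F n V (GenProj.pt F r) ^ m) w) = 0) ∧
      (∀ a b : Fin n, a < b →
        wittRep F n V (xpd F a b) ((wittRep F n V (GenProj.pt F r) ^ m) w) = 0) ∧
      ∀ a, wittRep F n V (xpd F a a) ((wittRep F n V (GenProj.pt F r) ^ m) w) =
        (κ a + if a = r then (m : F) else 0) • (wittRep F n V (GenProj.pt F r) ^ m) w := by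
    intro m
    induction m with
    | zero => exact ⟨hw, h.pt, fun l hl => h.pd l hl.le, h.raise, fun a => by simpa using hκ a⟩
    | succ m ih =>
      obtain ⟨h1, h2, h3, h4, h5⟩ := ih
      rw [pow_succ', Module.End.mul_apply]
      refine ⟨wittRep_pt_mem_UP r h1, fun l hl => ?_, fun l hl => ?_, fun a b hab => ?_,
        fun a => ?_⟩
      · have := LinearMap.congr_fun (wittRep_pt_comm (V := V) l r).eq
          ((wittRep F n V (GenProj.pt F r) ^ m) w)
        rw [Module.End.mul_apply, Module.End.mul_apply, h2 l hl, map_zero] at this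
        exact this
      · rw [wittRep_pd_pt, h3 l hl, h4 r l hl, if_neg (by rintro rfl; exact lt_irrefl _ hl)]
        simp
      · rw [wittRep_xpd_pt, h4 a b hab, map_zero, zero_add]
        split_ifs with hb
        · exact h2 a (by subst hb; exact hab)
        · rfl
      · rw [wittRep_xpd_pt, h5, map_smul]
        split_ifs with ha
        · subst ha
          rw [Nat.cast_add, Nat.cast_one]
          module
        · rw [add_zero]
  obtain ⟨h1, h2, h3, h4, h5⟩ := key M
  refine ⟨_, ⟨fun l hl => ?_, h3, h4⟩, h1, hne, fun a => ?_⟩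
  · rcases (Nat.lt_succ_iff_lt_or_eq).1 hl with hl | hl
    · exact h2 l hl
    · rw [Fin.ext hl, ← Module.End.mul_apply, ← pow_succ']
      exact hzero
  · rw [h5]
    congr 1
    split_ifs with ha
    · rw [← hM, ha]
      ring
    · rw [add_zero]

variable {μ : Fin n → F} {v : V}

theorem isExtremal_one_tmul (hv : IsHighestVec μ v) :
    IsExtremal 0 ((1 : PolyAlg F n) ⊗ₜ[F] v) where
  pt l hl := absurd hl (Nat.not_lt_zero _)
  pd l _ := by rw [wittRep_pd_tmul, Derivation.map_one_eq_zero, TensorProduct.zero_tmul]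
  raise a b hab := by
    rw [wittRep_xpd_tmul, Derivation.map_one_eq_zero, hv.raise a b hab, TensorProduct.zero_tmul,
      TensorProduct.tmul_zero, add_zero]

theorem wittRep_diag_one_tmul (hv : IsHighestVec μ v) (a : Fin n) :
    wittRep F n V (xpd F a a) ((1 : PolyAlg F n) ⊗ₜ[F] v) =
      μ a • ((1 : PolyAlg F n) ⊗ₜ[F] v) := by
  rw [wittRep_xpd_tmul, Derivation.map_one_eq_zero, hv.diag, TensorProduct.zero_tmul, zero_add,
    TensorProduct.tmul_smul]

/-- ν is the gl(n+1)-weight with total 0 that extends μ. After r reflections the diagonal operators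
x_a ∂_a read off ν with entry r omitted, so one reflection moves the omission by one place. -/
theorem exists_isExtremal [CharZero F] [Module.Finite F (UP F n V)] (hv : IsHighestVec μ v)
    (ν : Fin (n + 1) → F) (hν : ν = Fin.cons (-∑ j, μ j) μ) (r : Fin (n + 1)) :
    ∃ w : PolyAlg F n ⊗[F] V, IsExtremal r w ∧ w ∈ UP F n V ∧ w ≠ 0 ∧
      ∀ a, wittRep F n V (xpd F a a) w = ν (r.succAbove a) • w := by
  have hsum : ∀ r : Fin (n + 1), ∑ l, ν (r.succAbove l) = -ν r := by
    intro r
    rw [eq_neg_iff_add_eq_zero, add_comm, ← Fin.sum_univ_succAbove, hν, Fin.sum_univ_succ]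
    simp
  induction r using Fin.induction with
  | zero =>
    refine ⟨1 ⊗ₜ v, isExtremal_one_tmul hv, one_tmul_mem_UP v,
      fun h => hv.ne_zero (eq_zero_of_one_tmul h), fun a => ?_⟩
    rw [wittRep_diag_one_tmul hv, hν]
    simp
  | succ r ih =>
    obtain ⟨w, h1, h2, h3, h4⟩ := ih
    obtain ⟨w', h1', h2', h3', h4'⟩ := IsExtremal.step r h1 h2 h3 h4
    refine ⟨w', by simpa using h1', h2', h3', fun a => ?_⟩
    rw [h4', hsum, neg_neg]
    congr 1
    split_ifs with h
    · rw [h, Fin.succAbove_succ_self]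
    · rcases lt_or_gt_of_ne h with h | h
      · rw [Fin.succAbove_of_castSucc_lt _ _ (by simpa using h),
          Fin.succAbove_of_castSucc_lt _ _ (by
            rw [Fin.lt_def] at h ⊢; simp; omega)]
      · rw [Fin.succAbove_of_le_castSucc _ _ (by simpa using h.le),
          Fin.succAbove_of_le_castSucc _ _ (by
            rw [Fin.lt_def] at h; rw [Fin.le_def]; simp; omega)]

/-- After all n reflections the vector is killed by P and the raising operators, and its weight on
the coroots is given by consecutive differences of ν; irreducibility makes it a generator. -/
theorem isHighestWeightModule_UPLie [CharZero F] [Module.Finite F (UP F n V)] [NeZero n]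
    [LieModule.IsIrreducible F (Gl F n) V] (hv : IsHighestVec μ v) {k : ℕ}
    (hk : μ 0 + ∑ j, μ j = -(k : F)) :
    IsHighestWeightModule (UPLie F n V) (topWeight k μ) := by
  have : LieModule.IsIrreducible F (projLie F n) (UPLie F n V) := isIrreducible_UPLie
  obtain ⟨w, h1, hw, h0, h2⟩ := exists_isExtremal hv _ rfl (Fin.last n)
  set ν : Fin (n + 1) → F := Fin.cons (-∑ j, μ j) μ with hν
  simp only [Fin.succAbove_last] at h2
  have hsum : ∑ a : Fin n, ν a.castSucc = -ν (Fin.last n) := by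
    rw [eq_neg_iff_add_eq_zero, ← Fin.sum_univ_castSucc, hν, Fin.sum_univ_succ]
    simp
  have htop : ∀ i : Fin n, topWeight k μ i = ν i.castSucc - ν i.succ := by
    intro i
    rw [topWeight, hν, Fin.cons_succ]
    split_ifs with h
    · have hi : i = 0 := Fin.ext h
      subst hi
      rw [Fin.castSucc_zero', Fin.cons_zero, eq_comm, ← neg_eq_iff_eq_neg.2 hk]
      ring
    · have hi : i.castSucc = Fin.succ ⟨(i : ℕ) - 1, by omega⟩ := Fin.ext (by simp; omega)
      rw [hi, Fin.cons_succ]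
  have he : wittRep F n V (euler F n) w = (-ν (Fin.last n)) • w := by
    rw [wittRep_euler, Finset.sum_congr rfl fun a _ => h2 a, ← Finset.sum_smul, hsum]
  let z : UPLie F n V := ⟨w, hw⟩
  have hz : z ≠ 0 := fun h => h0 (congrArg Subtype.val h)
  refine ⟨z, hz, fun i => Subtype.ext ?_, fun i => Subtype.ext ?_, ?_⟩
  · change wittRep F n V (chevE F i) w = 0
    rw [chevE]
    split_ifs with h
    · exact h1.raise _ _ (by rw [Fin.lt_def]; simp)
    · exact h1.pt i i.2
  · change wittRep F n V (chevH F i) w = topWeight k μ i • w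
    rw [chevH, htop]
    split_ifs with h
    · change wittRep F n V (xpd F i i - xpd F ⟨i + 1, h⟩ ⟨i + 1, h⟩) w = _
      have hi : (⟨i + 1, h⟩ : Fin n).castSucc = i.succ := rfl
      rw [map_sub, LinearMap.sub_apply, h2, h2, hi]
      exact (sub_smul _ _ _).symm
    · change wittRep F n V (euler F n + xpd F i i) w = _
      have hi : i.succ = Fin.last n := Fin.ext (by simp; omega)
      rw [map_add, LinearMap.add_apply, h2, he, hi]
      module
  · have hmem : z ∈ LieSubmodule.lieSpan F (projLie F n) {z} :=
      LieSubmodule.subset_lieSpan rfl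
    have : Nontrivial (LieSubmodule.lieSpan F (projLie F n) {z}) :=
      ⟨⟨⟨z, hmem⟩, 0, fun h => hz (congrArg Subtype.val h)⟩⟩
    exact LieSubmodule.eq_top_of_isIrreducible F (projLie F n) (UPLie F n V) _

/-- The p_0-string through 1 ⊗ v is finite, so the primitive weight -(μ_0 + |μ|) is a natural
number. -/
theorem exists_nat_of_finite_UP [CharZero F] [Module.Finite F (UP F n V)] [NeZero n]
    (hv : IsHighestVec μ v) : ∃ m : ℕ, μ 0 + ∑ j, μ j = -(m : F) := by
  have he : wittRep F n V (euler F n) (1 ⊗ₜ v) = (∑ j, μ j) • ((1 : PolyAlg F n) ⊗ₜ[F] v) := by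
    rw [wittRep_euler, Finset.sum_congr rfl fun a _ => wittRep_diag_one_tmul hv a, Finset.sum_smul]
  obtain ⟨m, hm, -⟩ := exists_pt_string 0 (one_tmul_mem_UP v)
    (fun h => hv.ne_zero (eq_zero_of_one_tmul h)) ((isExtremal_one_tmul hv).pd 0 (Nat.zero_le _))
    (wittRep_diag_one_tmul hv 0) he
  exact ⟨m, by rw [← hm, neg_neg]⟩

end HighestWeight

/-! ### Extracting the critical index from the failing condition -/

section CriticalIndex

variable {F : Type*} [Field F] [CharZero F] {n : ℕ}

/-- If the irreducibility conditions fail, then the shifted weight `μ_i + |μ| - i` (`i` counted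
from `0`) drops at some index from values `≥ 2` to a value `≤ 0`, or is `≤ 0` throughout. -/
theorem exists_critical_index [NeZero n] {μ : Fin n → F}
    (hdom : ∀ i j : Fin n, i < j → ∃ N : ℕ, μ i - μ j = N)
    (hfail : ¬ (CondFirst μ ∧ CondRest μ)) :
    ∃ (i₀ : Fin n) (k : ℕ), μ i₀ + ∑ j, μ j - (i₀ : ℕ) = -(k : F) ∧
      ∀ i < i₀, ∃ r : ℕ, μ i + ∑ j, μ j - (i : ℕ) = (r : F) + 2 := by
  -- With a_i = s and gap d the next value is s - d - 1, so 2 ≤ s ≤ 1 + d says precisely that it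
  -- falls from ≥ 2 to ≤ 0.
  have drop : ∀ (i : Fin n) (h : (i : ℕ) + 1 < n) (s d : ℤ),
      μ i + ∑ j, μ j - (i : ℕ) = (s : F) → μ i - μ ⟨i + 1, h⟩ = (d : F) → 2 ≤ s → s ≤ 1 + d →
      ∃ (i₀ : Fin n) (k : ℕ), μ i₀ + ∑ j, μ j - (i₀ : ℕ) = -(k : F) ∧
        ∀ i < i₀, ∃ r : ℕ, μ i + ∑ j, μ j - (i : ℕ) = (r : F) + 2 := by
    intro i h s d hs hd h2 hsd
    obtain ⟨k, hk⟩ := Int.eq_ofNat_of_zero_le (show 0 ≤ 1 + d - s by omega)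
    obtain ⟨r, hr⟩ := Int.eq_ofNat_of_zero_le (show 0 ≤ s - 2 by omega)
    have hk' : (1 : F) + d - s = k := by exact_mod_cast congrArg (Int.cast : ℤ → F) hk
    have hr' : (s : F) - 2 = r := by exact_mod_cast congrArg (Int.cast : ℤ → F) hr
    refine ⟨⟨i + 1, h⟩, k, ?_, fun j hj => ?_⟩
    · rw [← hk', ← hd, ← hs]
      push_cast
      ring
    · rcases (Nat.lt_succ_iff_lt_or_eq).1 (Fin.lt_def.1 hj) with hj | hj
      · obtain ⟨N, hN⟩ := hdom j i hj
        refine ⟨r + N + (i - j : ℕ), ?_⟩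
        rw [Nat.cast_add, Nat.cast_add, ← hr', ← hs, ← hN, Nat.cast_sub hj.le]
        ring
      · have hji : j = i := Fin.ext hj
        exact ⟨r, by rw [hji, hs, ← hr']; ring⟩
  rw [not_and_or] at hfail
  rcases hfail with h | h
  · rw [CondFirst, not_and_or] at h
    rcases h with h | h
    · obtain ⟨k, hk⟩ := not_not.1 h
      exact ⟨0, k, by simpa using hk, fun i hi => absurd (Fin.lt_def.1 hi) (Nat.not_lt_zero _)⟩
    · push Not at h
      obtain ⟨h, p, q, s, hp, hq, hs, hps, hsq⟩ := h
      have hp' : p = 2 := by exact_mod_cast hp.symm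
      have h1 : (⟨((0 : Fin n) : ℕ) + 1, h⟩ : Fin n) = ⟨1, h⟩ := rfl
      -- The segment in the first condition ends at 1 + (μ_0 - μ_1), one more than the gap.
      refine drop 0 h s (q - 1) (by simpa using hs) ?_ (by omega) (by omega)
      rw [h1, Int.cast_sub, ← hq]
      push_cast
      ring
  · rw [CondRest] at h
    push Not at h
    obtain ⟨i, h, -, p, q, s, hp, hq, hs, hps, hsq⟩ := h
    have hp' : p = 1 := by exact_mod_cast hp.symm
    -- The second condition subtracts the 1-based index, so a_i is s + 1.
    refine drop i h (s + 1) q ?_ hq (by omega) (by omega)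
    rw [Int.cast_add, ← hs, Int.cast_one]
    ring

end CriticalIndex

end GenProj

end

/-! ### Assembly of the theorem -/

theorem corollary3p3p11 {F : Type*} [Field F] [CharZero F] {n : ℕ} [NeZero n]
    {V : Type*} [AddCommGroup V] [Module F V] [Module.Finite F V]
    [LieRingModule (GenProj.Gl F n) V] [LieModule F (GenProj.Gl F n) V]
    [LieModule.IsIrreducible F (GenProj.Gl F n) V]
    (μ : Fin n → F) (hμ : GenProj.HasHighestWeight V μ)
    (hfail : ¬ (GenProj.CondFirst μ ∧ GenProj.CondRest μ)) :
    ∃ i₀ : Fin n,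
      IsLeast {i : Fin n | μ i + ∑ j, μ j - ((i : ℕ) + 1 : F) + 1 ∈ GenProj.negNat F} i₀ ∧
      ∃ k : ℕ, (k : F) = -μ i₀ - ∑ j, μ j + ((i₀ : ℕ) + 1 : F) - 1 ∧
        (∀ j, j ≤ k → GenProj.degAV F n V j = GenProj.degUP F n V j) ∧
        (∀ j, k + 1 ≤ j → GenProj.degAV F n V j ≠ GenProj.degUP F n V j) ∧
        ∃ N : LieSubmodule F (GenProj.projLie F n) (GenProj.PolyAlg F n ⊗[F] V),
          N.toSubmodule = GenProj.UP F n V ∧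
          LieModule.IsIrreducible F (GenProj.projLie F n) N ∧
          ((Module.Finite F N ∧
              GenProj.IsHighestWeightModule N (GenProj.topWeight k μ)) ↔ (i₀ : ℕ) = 0) := by
  obtain ⟨v, hv0, hraise, hdiag⟩ := hμ
  have hv : GenProj.IsHighestVec μ v := ⟨hv0, hraise, hdiag⟩
  have hdom : ∀ i j : Fin n, i < j → ∃ N : ℕ, μ i - μ j = N := fun i j h =>
    GenProj.exists_nat_sub hv h
  obtain ⟨i₀, k, hk, hpos⟩ := GenProj.exists_critical_index hdom hfail
  have hleast : ∀ i, μ i + ∑ j, μ j - ((i : ℕ) + 1 : F) + 1 ∈ GenProj.negNat F → i₀ ≤ i := by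
    rintro i ⟨m, hm⟩
    by_contra! hlt
    obtain ⟨r, hr⟩ := hpos i hlt
    have h1 : ((r + 2 + m : ℕ) : F) = 0 := by
      push_cast
      rw [← hr]
      linear_combination hm
    have := Nat.cast_eq_zero.1 h1
    omega
  refine ⟨i₀, ⟨⟨k, by linear_combination hk⟩, hleast⟩, k, by linear_combination hk,
    fun j hj => GenProj.degAV_eq_degUP hv j fun i s hs h0 => ?_,
    fun j hj => GenProj.degAV_ne_degUP_of_le hj
      (GenProj.degAV_ne_degUP hv i₀ k (by rw [hk, neg_add_cancel]) fun r hr => ?_),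
    GenProj.UPLie F n V, rfl, GenProj.isIrreducible_UPLie, fun h => ?_, fun h => ?_⟩
  -- Before i₀ the numbers a_i + s are positive; from i₀ on a_i ≤ -k, so a zero would need s ≥ k.
  · rcases lt_or_ge i i₀ with hi | hi
    · obtain ⟨r, hr⟩ := hpos i hi
      rw [hr] at h0
      have h1 : ((r + 2 + s : ℕ) : F) = 0 := by exact_mod_cast h0
      have := Nat.cast_eq_zero.1 h1
      omega
    · have hle : ∃ N : ℕ, μ i₀ - μ i = N := by
        rcases hi.lt_or_eq with hi | rfl
        · exact hdom _ _ hi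
        · exact ⟨0, by simp⟩
      obtain ⟨N, hN⟩ := hle
      have h1 : ((s : ℕ) : F) = (k + N + (i - i₀ : ℕ) : ℕ) := by
        rw [Nat.cast_add, Nat.cast_add, Nat.cast_sub hi, ← hN]
        linear_combination h0 - hk
      have := Nat.cast_injective h1
      omega
  -- At r = i₀ - 1 one has a_r = m + 2, so the gap μ_r - μ_{i₀} = a_r + k - 1 equals k + 1 + m; the
  -- lower bound 2 is exactly what dominance requires.
  · obtain ⟨m, hm⟩ := hpos r (Fin.lt_def.2 (by omega))
    refine ⟨m, ?_⟩
    rw [← hr] at hk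
    push_cast at hk ⊢
    linear_combination hm - hk
  · have : Module.Finite F (GenProj.UP F n V) := h.1
    obtain ⟨m, hm⟩ := GenProj.exists_nat_of_finite_UP hv
    exact Nat.le_zero.1 (hleast 0 ⟨m, by simpa using hm⟩)
  · have h0 : i₀ = 0 := Fin.ext h
    subst h0
    have hk0 : μ 0 + ∑ j, μ j = -(k : F) := by simpa using hk
    have : Module.Finite F (GenProj.UP F n V) := GenProj.finite_UP hv hk0
    exact ⟨this, GenProj.isHighestWeightModule_UPLie hv hk0⟩
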